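/- Let $I,X,Y,Z$ be the Pauli matrices. A Clifford unitary on $n$ qubits is a unitary that maps the $n$-qubit Pauli group (with phases $\pm1,\pm i$) to itself under conjugation. Let $\mathbb F$ be the set of stabilizer states, i.e. on $n$ qubits the convex hull of the states $U|0^n\rangle\langle 0^n|U^\dagger$ with $U$ a Clifford unitary. Let $\mathbb O$ be the set of completely stabilizer-preserving channels, i.e. completely positive trace-preserving maps $\mathcal E$ on qubits such that for every $m\in\mathbb N$ the map $\mathcal E\otimes\mathcal I_m$ ($\mathcal I_m$ the identity on $m$ qubits) sends stabilizer states to stabilizer states. For a map $\mathcal E$ on $n$ qubits let $J_{\mathcal E}=(\mathcal E\otimes\mathcal I)(|\Psi\rangle\langle\Psi|)$ with $|\Psi\rangle=2^{-n/2}\sum_i|i\rangle|i\rangle$ be its Choi state. For a state $\rho$ and a channel $\mathcal E$ define the resource robustness and the resource weight by $$R_{\mathbb F}(\rho)=\min\{\lambda\ge1\mid\exists\sigma\in\mathbb F,\ \rho\le\lambda\sigma\},\qquad W_{\mathbb F}(\rho)=\max\{\lambda\le1\mid\exists\sigma\in\mathbb F,\ \rho\ge\lambda\sigma\},$$ $$R_{\mathbb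 O}(\mathcal E)=\min\{\lambda\ge1\mid\exists\mathcal M\in\mathbb O,\ J_{\mathcal E}\le\lambda J_{\mathcal M}\},\qquad W_{\mathbb O}(\mathcal E)=\max\{\lambda\le1\mid\exists\mathcal M\in\mathbb O,\ J_{\mathcal E}\ge\lambda J_{\mathcal M}\}.$$ Let $0\le\theta\le\pi/4$, let $\mathcal U(\cdot)=e^{-i\frac\theta2Z}\cdot e^{i\frac\theta2Z}$, let $p_0,p_x,p_y,p_z\ge0$ with $p_0+p_x+p_y+p_z=1$, let $\mathcal N(\cdot)=p_0\,\cdot+p_xX\cdot X+p_yY\cdot Y+p_zZ\cdot Z$, and let $\mathcal U_{\mathcal N}=\mathcal N\circ\mathcal U$. For $p\in[0,1]$ put $x=|1-2p|\cos\theta$, $y=|1-2p|\sin\theta$, and $$R(\theta,p)=\begin{cases}1&(y\le1-x)\\ \frac{\sqrt2+x+y}{\sqrt2+1}&(y\ge1-x),\end{cases}$$ $$W(\theta,p)=\begin{cases}1&(y\le1-x)\\ \frac{\sqrt2-(x+y)}{\sqrt2-1}&(1-x\le y\le(\sqrt2+1)(1-x))\\ \frac{1-(x^2+y^2)}{2(1-x)}&(y>(\sqrt2+1)(1-x)).\end{cases}$$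 (Overlapping cases agree. If $x=1$, then $y=0$ and the first case applies.) Then the following hold, where all the minima and maxima involved are attained. (i) For every $p\in[0,1]$, the single-qubit state $\rho(\theta,p)=\frac12\bigl(I+(1-2p)(\cos\theta\,X+\sin\theta\,Y)\bigr)$ satisfies $R_{\mathbb F}(\rho(\theta,p))=R(\theta,p)$ and $W_{\mathbb F}(\rho(\theta,p))=W(\theta,p)$. (ii) The noisy rotation satisfies $$R_{\mathbb O}(\mathcal U_{\mathcal N})=(p_0+p_z)\,R\Bigl(\theta,\tfrac{p_z}{p_0+p_z}\Bigr)+(p_x+p_y)\,R\Bigl(\theta,\tfrac{p_y}{p_x+p_y}\Bigr),$$ $$W_{\mathbb O}(\mathcal U_{\mathcal N})=(p_0+p_z)\,W\Bigl(\theta,\tfrac{p_z}{p_0+p_z}\Bigr)+(p_x+p_y)\,W\Bigl(\theta,\tfrac{p_y}{p_x+p_y}\Bigr),$$ where a term whose prefactor $p_0+p_z$ or $p_x+p_y$ is $0$ is read as $0$. -/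

import Mathlib

open scoped Matrix ComplexOrder

noncomputable section

namespace Magic

/-- Operators on `n` qubits, as matrices in the computational basis, which is labelled by
the bit strings `Fin n → Fin 2`. -/
abbrev QMat (n : ℕ) : Type := Matrix (Fin n → Fin 2) (Fin n → Fin 2) ℂ

/-- Linear maps on operators of `n` qubits. -/
abbrev SuperOp (n : ℕ) : Type := QMat n →ₗ[ℂ] QMat n

/-- The four single-qubit Pauli matrices, in the order `I, X, Y, Z`. -/
def pauli : Fin 4 → Matrix (Fin 2) (Fin 2) ℂ :=
  ![1, !![0, 1; 1, 0], !![0, -Complex.I; Complex.I, 0], !![1, 0; 0, -1]]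

/-- The tensor product `P₀ ⊗ ⋯ ⊗ P₍ₙ₋₁₎` of Pauli matrices. -/
def pauliString {n : ℕ} (P : Fin n → Fin 4) : QMat n :=
  Matrix.of fun a b => ∏ i, pauli (P i) (a i) (b i)

/-- The `n`-qubit Pauli group, with phases `1, i, -1, -i`. -/
def pauliGroup (n : ℕ) : Set (QMat n) :=
  {A | ∃ (k : ℕ) (P : Fin n → Fin 4), A = Complex.I ^ k • pauliString P}

/-- Clifford unitaries: unitaries that map the Pauli group to itself by conjugation. -/
def IsClifford {n : ℕ} (U : QMat n) : Prop :=
  U ∈ Matrix.unitaryGroup (Fin n → Fin 2) ℂ ∧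
    ∀ A ∈ pauliGroup n, U * A * Uᴴ ∈ pauliGroup n

/-- The pure `n`-qubit stabilizer states `U |0⋯0⟩⟨0⋯0| U†` with `U` Clifford. -/
def pureStabStates (n : ℕ) : Set (QMat n) :=
  {ρ | ∃ U : QMat n, IsClifford U ∧ ρ = U * Matrix.single 0 0 1 * Uᴴ}

/-- The set `𝔽` of `n`-qubit stabilizer states: probabilistic mixtures of pure ones. -/
def stabStates (n : ℕ) : Set (QMat n) := convexHull ℝ (pureStabStates n)

/-- The map `E ⊗ id` on operators of the joint system of `n` qubits and a system with basis
`κ`: the map `E` is applied to every block `(⟨·,k| A |·,l⟩)` of `A`. -/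
def ampliation {n : ℕ} {κ : Type*} (E : SuperOp n)
    (A : Matrix ((Fin n → Fin 2) × κ) ((Fin n → Fin 2) × κ) ℂ) :
    Matrix ((Fin n → Fin 2) × κ) ((Fin n → Fin 2) × κ) ℂ :=
  Matrix.of fun a b => E (Matrix.of fun s t => A (s, a.2) (t, b.2)) a.1 b.1

/-- An operator on the joint system of `n` and `m` qubits, as an operator on `n + m` qubits. -/
def joinQubits {n m : ℕ}
    (A : Matrix ((Fin n → Fin 2) × (Fin m → Fin 2)) ((Fin n → Fin 2) × (Fin m → Fin 2)) ℂ) :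
    QMat (n + m) :=
  Matrix.reindex (Fin.appendEquiv n m) (Fin.appendEquiv n m) A

/-- Completely positive and trace-preserving maps. -/
def IsCPTP {n : ℕ} (E : SuperOp n) : Prop :=
  (∀ (k : ℕ) (A : Matrix ((Fin n → Fin 2) × Fin k) ((Fin n → Fin 2) × Fin k) ℂ),
    A.PosSemidef → (ampliation E A).PosSemidef) ∧
  ∀ A : QMat n, (E A).trace = A.trace

/-- The set `𝕆` of completely stabilizer-preserving channels: those `E` for which `E ⊗ id`
maps stabilizer states to stabilizer states for every number `m` of additional qubits. -/
def csp (n : ℕ) : Set (SuperOp n) :=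
  {E | IsCPTP E ∧
    ∀ (m : ℕ)
      (σ : Matrix ((Fin n → Fin 2) × (Fin m → Fin 2)) ((Fin n → Fin 2) × (Fin m → Fin 2)) ℂ),
      joinQubits σ ∈ stabStates (n + m) → joinQubits (ampliation E σ) ∈ stabStates (n + m)}

/-- The maximally entangled vector `2^(-n/2) ∑ᵢ |i⟩|i⟩`. -/
def maxEntangled (n : ℕ) : (Fin n → Fin 2) × (Fin n → Fin 2) → ℂ :=
  fun a => if a.1 = a.2 then ((Real.sqrt (2 ^ n))⁻¹ : ℝ) else 0

/-- The Choi state `J_E = (E ⊗ id)(|Ψ⟩⟨Ψ|)`. -/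
def choi {n : ℕ} (E : SuperOp n) :
    Matrix ((Fin n → Fin 2) × (Fin n → Fin 2)) ((Fin n → Fin 2) × (Fin n → Fin 2)) ℂ :=
  ampliation E (Matrix.vecMulVec (maxEntangled n) (star (maxEntangled n)))

/-- `r = min {λ ≥ 1 | ∃ σ ∈ 𝔽, ρ ≤ λ σ}`: the number `r` is the resource robustness of `ρ`. -/
def IsStateRobustness {n : ℕ} (ρ : QMat n) (r : ℝ) : Prop :=
  IsLeast {l : ℝ | 1 ≤ l ∧ ∃ σ ∈ stabStates n, (l • σ - ρ).PosSemidef} r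

/-- `w = max {λ ≤ 1 | ∃ σ ∈ 𝔽, ρ ≥ λ σ}`: the number `w` is the resource weight of `ρ`. -/
def IsStateWeight {n : ℕ} (ρ : QMat n) (w : ℝ) : Prop :=
  IsGreatest {l : ℝ | l ≤ 1 ∧ ∃ σ ∈ stabStates n, (ρ - l • σ).PosSemidef} w

/-- `r = min {λ ≥ 1 | ∃ M ∈ 𝕆, J_E ≤ λ J_M}`: the number `r` is the resource robustness of the
channel `E`. -/
def IsChannelRobustness {n : ℕ} (E : SuperOp n) (r : ℝ) : Prop :=
  IsLeast {l : ℝ | 1 ≤ l ∧ ∃ M ∈ csp n, (l • choi M - choi E).PosSemidef} r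

/-- `w = max {λ ≤ 1 | ∃ M ∈ 𝕆, J_E ≥ λ J_M}`: the number `w` is the resource weight of the
channel `E`. -/
def IsChannelWeight {n : ℕ} (E : SuperOp n) (w : ℝ) : Prop :=
  IsGreatest {l : ℝ | l ≤ 1 ∧ ∃ M ∈ csp n, (choi E - l • choi M).PosSemidef} w

/-- The Pauli operator `X` on one qubit. -/
def opX : QMat 1 := pauliString ![1]

/-- The Pauli operator `Y` on one qubit. -/
def opY : QMat 1 := pauliString ![2]

/-- The Pauli operator `Z` on one qubit. -/
def opZ : QMat 1 := pauliString ![3]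

/-- The linear map `ρ ↦ A ρ B`. -/
def sandwich {n : ℕ} (A B : QMat n) : SuperOp n :=
  LinearMap.mulLeft ℂ A ∘ₗ LinearMap.mulRight ℂ B

/-- The rotation gate `ρ ↦ e^(-iθZ/2) ρ e^(iθZ/2)`. -/
def rotZ (θ : ℝ) : SuperOp 1 :=
  sandwich (NormedSpace.exp ((-(Complex.I * ((θ / 2 : ℝ) : ℂ))) • opZ))
    (NormedSpace.exp ((Complex.I * ((θ / 2 : ℝ) : ℂ)) • opZ))

/-- The Pauli noise `ρ ↦ p₀ ρ + pₓ XρX + p_y YρY + p_z ZρZ`. -/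
def pauliNoise (p0 px py pz : ℝ) : SuperOp 1 :=
  (p0 : ℂ) • LinearMap.id + (px : ℂ) • sandwich opX opX + (py : ℂ) • sandwich opY opY +
    (pz : ℂ) • sandwich opZ opZ

/-- The noisy rotation gate: the rotation followed by the Pauli noise. -/
def noisyRotZ (θ p0 px py pz : ℝ) : SuperOp 1 := pauliNoise p0 px py pz ∘ₗ rotZ θ

/-- The state `ρ(θ,p) = (I + (1 - 2p)(cos θ X + sin θ Y)) / 2`. -/
def xyState (θ p : ℝ) : QMat 1 :=
  (1 / 2 : ℂ) • (1 + ((1 - 2 * p : ℝ) : ℂ) •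
    (((Real.cos θ : ℝ) : ℂ) • opX + ((Real.sin θ : ℝ) : ℂ) • opY))

/-- The piecewise formula for the robustness, in `x = |1-2p| cos θ` and `y = |1-2p| sin θ`. -/
def robFormula (θ p : ℝ) : ℝ :=
  let x := |1 - 2 * p| * Real.cos θ
  let y := |1 - 2 * p| * Real.sin θ
  if y ≤ 1 - x then 1 else (Real.sqrt 2 + x + y) / (Real.sqrt 2 + 1)

/-- The piecewise formula for the weight, in `x = |1-2p| cos θ` and `y = |1-2p| sin θ`. -/
def weightFormula (θ p : ℝ) : ℝ :=
  let x := |1 - 2 * p| * Real.cos θ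
  let y := |1 - 2 * p| * Real.sin θ
  if y ≤ 1 - x then 1
  else if y ≤ (Real.sqrt 2 + 1) * (1 - x) then (Real.sqrt 2 - (x + y)) / (Real.sqrt 2 - 1)
  else (1 - (x ^ 2 + y ^ 2)) / (2 * (1 - x))

end Magic

end

/-!
The rotation about `Z` and the Pauli noise keep the Choi state block diagonal with respect to the
two codes stabilized by `Z ⊗ Z` and `-Z ⊗ Z`. Each code holds one logical qubit. The branches `I`
and `Z` of the noise contribute the state `ρ(θ, p)` with `p = p_z / (p₀ + p_z)` in the first code,
the branches `X` and `Y` contribute `ρ(θ, p)` with `p = p_y / (pₓ + p_y)` in the second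
(`choi_noisyRotZ_eq`). Thus states and channels lead to one planar problem per block.

*Free operators.* A qubit operator is described by its trace and by the `XY` part of its Bloch
vector. Stabilizer states lie in the octahedron, that is `|⟨X⟩| + |⟨Y⟩| ≤ ⟨I⟩`. The same inequality
holds for the projection of a two-qubit stabilizer state to each of the two codes; both follow from
`abs_add_abs_le_of_mem_pureStabStates`, because a Pauli operator either has expectation `0` in a
pure stabilizer state or is, up to sign, one of its stabilizers. Since the maximally entangled state
is a stabilizer state, the inequality applies to the Choi states of completely
stabilizer-preserving channels (`inOctahedralCone_choi`). In the other direction, the equatorial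
square of the octahedron is spanned by the Bloch vectors `iʲ`, which are those of the Choi states
of the Clifford gates `Xᵇ diag(1, iʲ)` (`exists_csp_smul_choi_eq`) and of stabilizer states
(`exists_stabStates_smul_eq`).

*The planar problem.* Positivity of `(t I + u X + v Y) / 2` means `u² + v² ≤ t²`. So the robustness
is the least `t` for which some point of the square `|u| + |v| ≤ t` is within distance `t - 1` of
the Bloch vector, and the weight is the greatest `t` for which some point of that square is within
distance `1 - t`. The optimal points are explicit (`robXY_feasible`, `weightXY_feasible`), and
linear witnesses show that they are optimal (`mul_robXY_le`, `le_mul_weightXY`). The bounds are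
homogeneous, so for channels they are summed over the two blocks.
-/

noncomputable section

namespace Magic

open scoped Kronecker

/-! ### Tensor products and the Pauli group -/

/-- The tensor product `M₀ ⊗ ⋯ ⊗ M₍ₙ₋₁₎` of single-qubit operators. -/
def tensorString {n : ℕ} (M : Fin n → Matrix (Fin 2) (Fin 2) ℂ) : QMat n :=
  Matrix.of fun a b => ∏ i, M i (a i) (b i)

theorem pauliString_eq {n : ℕ} (P : Fin n → Fin 4) :
    pauliString P = tensorString fun i => pauli (P i) := rfl

theorem tensorString_mul {n : ℕ} (M N : Fin n → Matrix (Fin 2) (Fin 2) ℂ) :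
    tensorString M * tensorString N = tensorString fun i => M i * N i := by
  ext a b
  simp only [tensorString, Matrix.mul_apply, Matrix.of_apply, ← Finset.prod_mul_distrib]
  rw [Finset.prod_univ_sum, Fintype.piFinset_univ]

theorem tensorString_conjTranspose {n : ℕ} (M : Fin n → Matrix (Fin 2) (Fin 2) ℂ) :
    (tensorString M)ᴴ = tensorString fun i => (M i)ᴴ := by
  ext a b
  simp [tensorString, Matrix.conjTranspose_apply]

theorem tensorString_one {n : ℕ} : tensorString (fun _ : Fin n => 1) = 1 := by
  ext a b
  simp only [tensorString, Matrix.of_apply, Matrix.one_apply]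
  split_ifs with h
  · subst h; simp
  · obtain ⟨i, hi⟩ := Function.ne_iff.1 h
    exact Finset.prod_eq_zero (Finset.mem_univ i) (if_neg hi)

theorem tensorString_smul {n : ℕ} (c : Fin n → ℂ) (M : Fin n → Matrix (Fin 2) (Fin 2) ℂ) :
    tensorString (fun i => c i • M i) = (∏ i, c i) • tensorString M := by
  ext a b
  simp [tensorString, Finset.prod_mul_distrib]

theorem pauli_mul (i j : Fin 4) :
    ∃ (k : ℕ) (l : Fin 4), pauli i * pauli j = Complex.I ^ k • pauli l := by
  refine ⟨(![![0, 0, 0, 0], ![0, 0, 1, 3], ![0, 3, 0, 1], ![0, 1, 3, 0]] : Fin 4 → Fin 4 → ℕ) i j,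
    (![![0, 1, 2, 3], ![1, 0, 3, 2], ![2, 3, 0, 1], ![3, 2, 1, 0]] : Fin 4 → Fin 4 → Fin 4) i j, ?_⟩
  fin_cases i <;> fin_cases j <;> simp [pauli, Matrix.one_fin_two]

theorem pauli_conjTranspose (i : Fin 4) : (pauli i)ᴴ = pauli i := by
  ext a b
  fin_cases i <;> fin_cases a <;> fin_cases b <;> simp [pauli]

theorem pauli_mul_self (i : Fin 4) : pauli i * pauli i = 1 := by
  fin_cases i <;> simp [pauli, Matrix.one_fin_two]

theorem pauli_mul_comm (i j : Fin 4) :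
    ∃ c : ℂ, (c = 1 ∨ c = -1) ∧ pauli i * pauli j = c • (pauli j * pauli i) := by
  refine ⟨(![![1, 1, 1, 1], ![1, 1, -1, -1], ![1, -1, 1, -1], ![1, -1, -1, 1]] :
    Fin 4 → Fin 4 → ℂ) i j, ?_, ?_⟩ <;>
  fin_cases i <;> fin_cases j <;> simp [pauli]

theorem pauliString_mem {n : ℕ} (P : Fin n → Fin 4) : pauliString P ∈ pauliGroup n :=
  ⟨0, P, by simp⟩

theorem one_mem_pauliGroup (n : ℕ) : (1 : QMat n) ∈ pauliGroup n :=
  ⟨0, fun _ => 0, by simp [pauliString_eq, pauli, tensorString_one]⟩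

theorem I_pow_smul_mem_pauliGroup {n : ℕ} {A : QMat n} (hA : A ∈ pauliGroup n) (k : ℕ) :
    Complex.I ^ k • A ∈ pauliGroup n := by
  obtain ⟨l, P, rfl⟩ := hA
  exact ⟨k + l, P, by rw [smul_smul, pow_add]⟩

theorem neg_mem_pauliGroup {n : ℕ} {A : QMat n} (hA : A ∈ pauliGroup n) :
    -A ∈ pauliGroup n := by
  simpa using I_pow_smul_mem_pauliGroup hA 2

theorem mul_mem_pauliGroup {n : ℕ} {A B : QMat n} (hA : A ∈ pauliGroup n)
    (hB : B ∈ pauliGroup n) : A * B ∈ pauliGroup n := by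
  obtain ⟨k, P, rfl⟩ := hA
  obtain ⟨l, Q, rfl⟩ := hB
  choose f g hfg using fun i => pauli_mul (P i) (Q i)
  refine ⟨k + l + ∑ i, f i, g, ?_⟩
  simp only [pauliString_eq, smul_mul_smul_comm, tensorString_mul, hfg, tensorString_smul,
    smul_smul, pow_add, Finset.prod_pow_eq_pow_sum]

theorem pauliString_conjTranspose {n : ℕ} (P : Fin n → Fin 4) :
    (pauliString P)ᴴ = pauliString P := by
  simp only [pauliString_eq, tensorString_conjTranspose, pauli_conjTranspose]

theorem pauliString_mul_self {n : ℕ} (P : Fin n → Fin 4) :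
    pauliString P * pauliString P = 1 := by
  simp only [pauliString_eq, tensorString_mul, pauli_mul_self, tensorString_one]

theorem conjTranspose_mem_pauliGroup {n : ℕ} {A : QMat n} (hA : A ∈ pauliGroup n) :
    Aᴴ ∈ pauliGroup n := by
  obtain ⟨k, P, rfl⟩ := hA
  -- `star (I ^ k) = (-I) ^ k = I ^ (3 * k)`
  refine ⟨3 * k, P, ?_⟩
  rw [Matrix.conjTranspose_smul, pauliString_conjTranspose, pow_mul]
  simp

theorem mul_conjTranspose_of_mem_pauliGroup {n : ℕ} {A : QMat n} (hA : A ∈ pauliGroup n) :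
    A * Aᴴ = 1 := by
  obtain ⟨k, P, rfl⟩ := hA
  rw [Matrix.conjTranspose_smul, pauliString_conjTranspose, smul_mul_smul_comm,
    pauliString_mul_self]
  simp [← mul_pow]

/-- Any two Pauli operators commute or anticommute. -/
theorem commute_or_anticommute {n : ℕ} {A B : QMat n} (hA : A ∈ pauliGroup n)
    (hB : B ∈ pauliGroup n) : A * B = B * A ∨ A * B = -(B * A) := by
  obtain ⟨k, P, rfl⟩ := hA
  obtain ⟨l, Q, rfl⟩ := hB
  choose c hc hcomm using fun i => pauli_mul_comm (P i) (Q i)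
  have hprod : (∏ i, c i) = 1 ∨ (∏ i, c i) = -1 := by
    refine Finset.prod_induction c (fun z => z = 1 ∨ z = -1) ?_ (Or.inl rfl) fun i _ => hc i
    rintro a b (rfl | rfl) (rfl | rfl) <;> simp
  have key : pauliString P * pauliString Q = (∏ i, c i) • (pauliString Q * pauliString P) := by
    simp only [pauliString_eq, tensorString_mul, hcomm, tensorString_smul]
  rw [smul_mul_smul_comm, smul_mul_smul_comm, key, mul_comm (Complex.I ^ l)]
  rcases hprod with h | h <;> simp [h]

theorem finite_pauliGroup (n : ℕ) : (pauliGroup n).Finite := by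
  refine (Set.finite_range fun x : Fin 4 × (Fin n → Fin 4) =>
    Complex.I ^ (x.1 : ℕ) • pauliString x.2).subset ?_
  rintro _ ⟨k, P, rfl⟩
  refine ⟨(⟨k % 4, Nat.mod_lt _ (by norm_num)⟩, P), ?_⟩
  simp only [← Complex.I_pow_eq_pow_mod]

/-! ### Clifford unitaries -/

theorem IsClifford.mul_conjTranspose {n : ℕ} {U : QMat n} (hU : IsClifford U) : U * Uᴴ = 1 :=
  Matrix.mem_unitaryGroup_iff.1 hU.1

theorem IsClifford.conjTranspose_mul {n : ℕ} {U : QMat n} (hU : IsClifford U) : Uᴴ * U = 1 :=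
  Matrix.mem_unitaryGroup_iff'.1 hU.1

theorem IsClifford.mul {n : ℕ} {U V : QMat n} (hU : IsClifford U) (hV : IsClifford V) :
    IsClifford (U * V) := by
  refine ⟨mul_mem hU.1 hV.1, fun A hA => ?_⟩
  have := hU.2 _ (hV.2 A hA)
  rwa [Matrix.conjTranspose_mul, show U * V * A * (Vᴴ * Uᴴ) = U * (V * A * Vᴴ) * Uᴴ by
    simp only [Matrix.mul_assoc]]

theorem isClifford_of_mem_pauliGroup {n : ℕ} {A : QMat n} (hA : A ∈ pauliGroup n) :
    IsClifford A :=
  ⟨Matrix.mem_unitaryGroup_iff.2 (mul_conjTranspose_of_mem_pauliGroup hA), fun _ hB =>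
    mul_mem_pauliGroup (mul_mem_pauliGroup hA hB) (conjTranspose_mem_pauliGroup hA)⟩

/-- A normalized sum of two "orthogonal" Pauli operators is a Clifford unitary. The Hadamard gate
`(X + Z) / √2`, the phase gate, and the entangling gate `(Z ⊗ 1 + X ⊗ X) / √2` are of this form. -/
theorem isClifford_smul_add {n : ℕ} {A B : QMat n} (hA : A ∈ pauliGroup n)
    (hB : B ∈ pauliGroup n) (hAB : A * Bᴴ + B * Aᴴ = 0) {c : ℂ} (hc : c * star c = 1 / 2) :
    IsClifford (c • (A + B)) := by
  have hAA := mul_conjTranspose_of_mem_pauliGroup hA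
  have hBB := mul_conjTranspose_of_mem_pauliGroup hB
  have hBA : B * Aᴴ = -(A * Bᴴ) := eq_neg_of_add_eq_zero_right hAB
  have expand (R : QMat n) : c • (A + B) * R * (c • (A + B))ᴴ =
      (1 / 2 : ℂ) • (A * R * Aᴴ + A * R * Bᴴ + B * R * Aᴴ + B * R * Bᴴ) := by
    rw [Matrix.conjTranspose_smul, smul_mul_assoc, smul_mul_smul_comm, hc,
      Matrix.conjTranspose_add]
    congr 1
    noncomm_ring
  have half (R : QMat n) : (1 / 2 : ℂ) • (R + R) = R := by
    rw [← two_smul ℂ, smul_smul]; norm_num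
  -- `R` is mapped to `± R` if both signs agree, and to `± R A Bᴴ` if they differ
  have key (R : QMat n) : ∀ s t : ℂ, A * R = s • (R * A) → B * R = t • (R * B) →
      c • (A + B) * R * (c • (A + B))ᴴ =
      (1 / 2 : ℂ) • ((s + t) • R + (s - t) • (R * (A * Bᴴ))) := by
    intro s t hs ht
    rw [expand, hs, ht]
    simp only [smul_mul_assoc, Matrix.mul_assoc, hAA, hBB, hBA, Matrix.mul_neg, Matrix.mul_one]
    module
  have hcomm {A R : QMat n} (hA : A ∈ pauliGroup n) (hR : R ∈ pauliGroup n) :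
      ∃ s : ℂ, (s = 1 ∨ s = -1) ∧ A * R = s • (R * A) := by
    rcases commute_or_anticommute hA hR with h | h
    · exact ⟨1, Or.inl rfl, by simpa using h⟩
    · exact ⟨-1, Or.inr rfl, by simpa using h⟩
  refine ⟨Matrix.mem_unitaryGroup_iff.2 ?_, fun R hR => ?_⟩
  · have := key 1 1 1 (by simp) (by simp)
    rw [Matrix.mul_one] at this
    rw [Matrix.star_eq_conjTranspose, this, sub_self, zero_smul, add_zero, add_smul, one_smul, half]
  · have hm := mul_mem_pauliGroup hR (mul_mem_pauliGroup hA (conjTranspose_mem_pauliGroup hB))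
    obtain ⟨s, hs, hsR⟩ := hcomm hA hR
    obtain ⟨t, ht, htR⟩ := hcomm hB hR
    rw [key R s t hsR htR]
    rcases hs with rfl | rfl <;> rcases ht with rfl | rfl
    · convert hR using 1; module
    · convert hm using 1; module
    · convert neg_mem_pauliGroup hm using 1; module
    · convert neg_mem_pauliGroup hR using 1; module

/-- Conjugation by a Clifford unitary permutes the finite Pauli group, so that every Pauli operator
is the image of a Pauli operator. -/
theorem IsClifford.exists_conj_eq {n : ℕ} {U : QMat n} (hU : IsClifford U) {A : QMat n}
    (hA : A ∈ pauliGroup n) : ∃ B ∈ pauliGroup n, U * B * Uᴴ = A := by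
  have hinj : Set.InjOn (fun B => U * B * Uᴴ) (pauliGroup n) := by
    intro B _ C _ h
    have := congrArg (fun D => Uᴴ * D * U) h
    simpa only [Matrix.mul_assoc, hU.conjTranspose_mul, Matrix.mul_one,
      ← Matrix.mul_assoc Uᴴ U, Matrix.one_mul] using this
  exact ((finite_pauliGroup n).injOn_iff_bijOn_of_mapsTo hU.2).1 hinj |>.surjOn hA

/-! ### Pauli expectations in pure stabilizer states -/

theorem conjTranspose_of_mem_pureStabStates {n : ℕ} {σ : QMat n} (hσ : σ ∈ pureStabStates n) :
    σᴴ = σ := by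
  obtain ⟨U, -, rfl⟩ := hσ
  simp [Matrix.conjTranspose_mul, Matrix.mul_assoc]

theorem trace_of_mem_pureStabStates {n : ℕ} {σ : QMat n} (hσ : σ ∈ pureStabStates n) :
    σ.trace = 1 := by
  obtain ⟨U, hU, rfl⟩ := hσ
  rw [Matrix.trace_mul_comm, ← Matrix.mul_assoc, hU.conjTranspose_mul, Matrix.one_mul,
    Matrix.trace_single_eq_same]

/-- A Pauli string either fixes `|0⋯0⟩`, or flips at least one qubit. -/
theorem pauliString_mul_single {n : ℕ} (P : Fin n → Fin 4) :
    pauliString P 0 0 = 0 ∨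
      pauliString P * Matrix.single 0 0 1 = (Matrix.single 0 0 1 : QMat n) := by
  by_cases h : ∃ i, pauli (P i) 0 0 = 0
  · obtain ⟨i, hi⟩ := h
    exact Or.inl (Finset.prod_eq_zero (Finset.mem_univ i) hi)
  · right
    push Not at h
    have h1 (i : Fin n) (a : Fin 2) : pauli (P i) a 0 = if a = 0 then 1 else 0 := by
      have := h i
      generalize P i = j at this
      fin_cases j <;> fin_cases a <;> simp [pauli] at this ⊢
    ext a b
    by_cases hb : b = 0
    · subst hb
      rw [Matrix.mul_single_apply_same]
      simp only [pauliString, Matrix.of_apply, Pi.zero_apply, h1, mul_one, Matrix.single_apply]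
      by_cases ha : a = 0
      · simp [ha]
      · obtain ⟨i, hi⟩ := Function.ne_iff.1 ha
        rw [Finset.prod_eq_zero (Finset.mem_univ i) (if_neg hi), if_neg]
        tauto
    · rw [Matrix.mul_single_apply_of_ne _ _ _ _ _ hb]
      rw [Matrix.single_apply, if_neg]
      tauto

theorem conjTranspose_of_mul_self {n : ℕ} {A : QMat n} (hA : A ∈ pauliGroup n)
    (hA2 : A * A = 1) : Aᴴ = A := by
  rw [← Matrix.one_mul Aᴴ, ← hA2, Matrix.mul_assoc, mul_conjTranspose_of_mem_pauliGroup hA,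
    Matrix.mul_one]

/-- A Hermitian Pauli operator either has expectation `0` in a pure stabilizer state, or that state
is an eigenvector of it. -/
theorem trace_eq_zero_or_mul_eq {n : ℕ} {σ : QMat n} (hσ : σ ∈ pureStabStates n) {A : QMat n}
    (hA : A ∈ pauliGroup n) (hA2 : A * A = 1) :
    (A * σ).trace = 0 ∨ ∃ s : ℂ, (s = 1 ∨ s = -1) ∧ A * σ = s • σ := by
  have htr := trace_of_mem_pureStabStates hσ
  obtain ⟨U, hU, rfl⟩ := hσ
  obtain ⟨B, ⟨k, P, rfl⟩, rfl⟩ := hU.exists_conj_eq hA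
  have hmul : U * Complex.I ^ k • pauliString P * Uᴴ * (U * Matrix.single 0 0 1 * Uᴴ) =
      Complex.I ^ k • (U * (pauliString P * Matrix.single 0 0 1) * Uᴴ) := by
    rw [show U * Complex.I ^ k • pauliString P * Uᴴ * (U * Matrix.single 0 0 1 * Uᴴ) =
      U * Complex.I ^ k • pauliString P * (Uᴴ * U) * Matrix.single 0 0 1 * Uᴴ by
        simp only [Matrix.mul_assoc], hU.conjTranspose_mul]
    simp [Matrix.mul_assoc]
  rcases pauliString_mul_single P with h | h
  · left
    rw [hmul, Matrix.trace_smul, Matrix.trace_mul_comm, ← Matrix.mul_assoc,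
      hU.conjTranspose_mul, Matrix.one_mul, Matrix.trace_mul_single]
    simp [h]
  · right
    rw [h] at hmul
    refine ⟨_, ?_, hmul⟩
    have sq (A S : QMat n) (c : ℂ) (hA : A * A = 1) (hS : S.trace = 1) (h : A * S = c • S) :
        c = 1 ∨ c = -1 := by
      have h2 : S = (c * c) • S := by
        rw [← smul_smul, ← h, ← Matrix.mul_smul, ← h, ← Matrix.mul_assoc, hA, Matrix.one_mul]
      have h3 := congrArg Matrix.trace h2
      rw [Matrix.trace_smul, hS] at h3
      exact mul_self_eq_one_iff.1 (by simpa using h3.symm)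
    exact sq _ _ _ hA2 htr hmul

/-- Pauli operators that anticommute with a stabilizer of a state have expectation `0` in it. -/
theorem trace_eq_zero_of_anticommute {n : ℕ} {σ : QMat n} (hσ : σ ∈ pureStabStates n)
    {A K : QMat n} (hA : A ∈ pauliGroup n) (hA2 : A * A = 1) {s : ℂ} (hs : s = 1 ∨ s = -1)
    (hAσ : A * σ = s • σ) (hAK : A * K = -(K * A)) : (K * σ).trace = 0 := by
  have hσA : σ * A = s • σ := by
    have := congrArg Matrix.conjTranspose hAσ
    rw [Matrix.conjTranspose_mul, Matrix.conjTranspose_smul, conjTranspose_of_mul_self hA hA2,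
      conjTranspose_of_mem_pureStabStates hσ] at this
    rcases hs with rfl | rfl <;> simpa using this
  have h1 : (A * K * σ).trace = s * (K * σ).trace := by
    rw [Matrix.mul_assoc, Matrix.trace_mul_comm, Matrix.mul_assoc, hσA, Matrix.mul_smul,
      Matrix.trace_smul, smul_eq_mul]
  rw [hAK, Matrix.neg_mul, Matrix.trace_neg, Matrix.mul_assoc, hAσ, Matrix.mul_smul,
    Matrix.trace_smul, smul_eq_mul] at h1
  rcases hs with rfl | rfl
  · linear_combination (-1 / 2) * h1
  · linear_combination (1 / 2) * h1

/-- A Pauli expectation in a pure stabilizer state is `0`, `1` or `-1`. If it is not `0`, then the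
expectations multiply, and those of anticommuting Pauli operators vanish. -/
theorem re_trace_cases {n : ℕ} {σ : QMat n} (hσ : σ ∈ pureStabStates n) {A : QMat n}
    (hA : A ∈ pauliGroup n) (hA2 : A * A = 1) :
    (A * σ).trace.re = 0 ∨ (((A * σ).trace.re = 1 ∨ (A * σ).trace.re = -1) ∧
      (∀ B : QMat n, (B * A * σ).trace.re = (A * σ).trace.re * (B * σ).trace.re) ∧
      ∀ K : QMat n, A * K = -(K * A) → (K * σ).trace.re = 0) := by
  rcases trace_eq_zero_or_mul_eq hσ hA hA2 with h | ⟨s, hs, h⟩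
  · simp [h]
  · refine Or.inr ⟨?_, fun B => ?_, fun K hK => ?_⟩
    · rw [h, Matrix.trace_smul, trace_of_mem_pureStabStates hσ]
      rcases hs with rfl | rfl <;> simp
    · rw [Matrix.mul_assoc, h, Matrix.mul_smul, Matrix.trace_smul, Matrix.trace_smul,
        trace_of_mem_pureStabStates hσ]
      rcases hs with rfl | rfl <;> simp
    · rw [trace_eq_zero_of_anticommute hσ hA hA2 hs h hK, Complex.zero_re]

/-- The octahedral inequality for the logical qubit of a stabilizer code: if `G₁`, `G₂` both act as
the logical `X` and `K₁`, `K₂` both act as the logical `Y` of the code with stabilizer `Q`, then a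
pure stabilizer state projected to that code lies in the cone over the octahedron. -/
theorem abs_add_abs_le_of_mem_pureStabStates {n : ℕ} {σ : QMat n} (hσ : σ ∈ pureStabStates n)
    {G₁ G₂ K₁ K₂ Q : QMat n} (hG₁ : G₁ ∈ pauliGroup n) (hG₂ : G₂ ∈ pauliGroup n)
    (hK₁ : K₁ ∈ pauliGroup n) (hK₂ : K₂ ∈ pauliGroup n) (hQ : Q ∈ pauliGroup n)
    (hG₁s : G₁ * G₁ = 1) (hG₂s : G₂ * G₂ = 1) (hK₁s : K₁ * K₁ = 1) (hK₂s : K₂ * K₂ = 1)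
    (hG₁₂ : G₁ * G₂ = Q) (hG₂₁ : G₂ * G₁ = Q) (hK₁₂ : K₁ * K₂ = Q) (hK₂₁ : K₂ * K₁ = Q)
    (h₁₁ : G₁ * K₁ = -(K₁ * G₁)) (h₁₂ : G₁ * K₂ = -(K₂ * G₁))
    (h₂₁ : G₂ * K₁ = -(K₁ * G₂)) (h₂₂ : G₂ * K₂ = -(K₂ * G₂)) :
    |(G₁ * σ).trace.re + (G₂ * σ).trace.re| + |(K₁ * σ).trace.re + (K₂ * σ).trace.re| ≤
      1 + (Q * σ).trace.re := by
  -- If a stabilizer of the state is among the four operators, then the two operators of the other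
  -- kind have expectation `0`, and `⟨Q⟩` is the product of the two expectations of its own kind.
  -- If all four expectations vanish, only `⟨Q⟩ ≥ -1` is needed.
  have hQs : Q * Q = 1 := by
    nth_rw 1 [← hG₁₂]
    rw [← hG₂₁, Matrix.mul_assoc, ← Matrix.mul_assoc G₂, hG₂s, Matrix.one_mul, hG₁s]
  have flip {A B : QMat n} (h : A * B = -(B * A)) : B * A = -(A * B) := by rw [h, neg_neg]
  have aux : ∀ a b : ℝ, (a = 1 ∨ a = -1) → (b = 0 ∨ b = 1 ∨ b = -1) → |a + b| ≤ 1 + a * b := by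
    rintro a b (rfl | rfl) (rfl | rfl | rfl) <;> norm_num
  have val {A : QMat n} (hA : A ∈ pauliGroup n) (hA2 : A * A = 1) :
      (A * σ).trace.re = 0 ∨ (A * σ).trace.re = 1 ∨ (A * σ).trace.re = -1 := by
    rcases re_trace_cases hσ hA hA2 with h | h
    · exact Or.inl h
    · exact Or.inr h.1
  rcases re_trace_cases hσ hG₁ hG₁s with a0 | ⟨a, hB, hK⟩
  · rcases re_trace_cases hσ hG₂ hG₂s with b0 | ⟨b, hB, hK⟩
    · rcases re_trace_cases hσ hK₁ hK₁s with c0 | ⟨c, hB, hK⟩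
      · rcases re_trace_cases hσ hK₂ hK₂s with d0 | ⟨d, hB, hK⟩
        · rw [a0, b0, c0, d0]
          rcases val hQ hQs with h | h | h <;> rw [h] <;> norm_num
        · rw [a0, b0, ← hK₁₂, hB, add_zero, abs_zero, zero_add, add_comm (K₁ * σ).trace.re]
          exact aux _ _ d (val hK₁ hK₁s)
      · rw [a0, b0, ← hK₂₁, hB, add_zero, abs_zero, zero_add]
        exact aux _ _ c (val hK₂ hK₂s)
    · rw [hK _ h₂₁, hK _ h₂₂, ← hG₁₂, hB, add_zero, abs_zero, add_zero,
        add_comm (G₁ * σ).trace.re]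
      exact aux _ _ b (val hG₁ hG₁s)
  · rw [hK _ h₁₁, hK _ h₁₂, ← hG₂₁, hB, add_zero, abs_zero, add_zero]
    exact aux _ _ a (val hG₂ hG₂s)

/-! ### Joint systems, Clifford channels and Choi states -/

theorem joinQubits_append {n m : ℕ}
    (A : Matrix ((Fin n → Fin 2) × (Fin m → Fin 2)) ((Fin n → Fin 2) × (Fin m → Fin 2)) ℂ)
    (x y : (Fin n → Fin 2) × (Fin m → Fin 2)) :
    joinQubits A (Fin.appendEquiv n m x) (Fin.appendEquiv n m y) = A x y := by
  simp [joinQubits]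

theorem joinQubits_mul {n m : ℕ}
    (A B : Matrix ((Fin n → Fin 2) × (Fin m → Fin 2)) ((Fin n → Fin 2) × (Fin m → Fin 2)) ℂ) :
    joinQubits (A * B) = joinQubits A * joinQubits B := by
  simp only [joinQubits, Matrix.reindex_apply, Matrix.submatrix_mul_equiv]

theorem joinQubits_conjTranspose {n m : ℕ}
    (A : Matrix ((Fin n → Fin 2) × (Fin m → Fin 2)) ((Fin n → Fin 2) × (Fin m → Fin 2)) ℂ) :
    joinQubits Aᴴ = (joinQubits A)ᴴ := rfl

theorem joinQubits_one {n m : ℕ} : joinQubits (1 : Matrix ((Fin n → Fin 2) × (Fin m → Fin 2))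
    ((Fin n → Fin 2) × (Fin m → Fin 2)) ℂ) = 1 := by
  simp [joinQubits]

theorem trace_joinQubits {n m : ℕ}
    (A : Matrix ((Fin n → Fin 2) × (Fin m → Fin 2)) ((Fin n → Fin 2) × (Fin m → Fin 2)) ℂ) :
    (joinQubits A).trace = A.trace :=
  Equiv.sum_comp (Fin.appendEquiv n m).symm fun x => A x x

theorem joinQubits_pauliString {n m : ℕ} (P : Fin n → Fin 4) (Q : Fin m → Fin 4) :
    joinQubits (pauliString P ⊗ₖ pauliString Q) = pauliString (Fin.append P Q) := by
  ext a b
  obtain ⟨x, rfl⟩ := (Fin.appendEquiv n m).surjective a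
  obtain ⟨y, rfl⟩ := (Fin.appendEquiv n m).surjective b
  rw [joinQubits_append]
  simp [pauliString, Matrix.kroneckerMap_apply, Fin.prod_univ_add]

theorem joinQubits_kronecker_mem {n m : ℕ} {A : QMat n} {B : QMat m} (hA : A ∈ pauliGroup n)
    (hB : B ∈ pauliGroup m) : joinQubits (A ⊗ₖ B) ∈ pauliGroup (n + m) := by
  obtain ⟨k, P, rfl⟩ := hA
  obtain ⟨l, Q, rfl⟩ := hB
  refine ⟨k + l, Fin.append P Q, ?_⟩
  rw [← joinQubits_pauliString, Matrix.smul_kronecker, Matrix.kronecker_smul, smul_smul, pow_add]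
  rfl

theorem IsClifford.kronecker_one {n m : ℕ} {U : QMat n} (hU : IsClifford U) :
    IsClifford (joinQubits (U ⊗ₖ (1 : QMat m))) := by
  refine ⟨Matrix.mem_unitaryGroup_iff.2 ?_, ?_⟩
  · rw [Matrix.star_eq_conjTranspose, ← joinQubits_conjTranspose, ← joinQubits_mul,
      Matrix.conjTranspose_kronecker, ← Matrix.mul_kronecker_mul, hU.mul_conjTranspose]
    simp [joinQubits_one]
  · rintro _ ⟨k, P, rfl⟩
    have hP : P = Fin.append (fun i => P (Fin.castAdd m i)) fun i => P (Fin.natAdd n i) :=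
      (Fin.append_castAdd_natAdd).symm
    rw [hP, ← joinQubits_pauliString, Matrix.mul_smul, Matrix.smul_mul,
      ← joinQubits_conjTranspose, ← joinQubits_mul, ← joinQubits_mul,
      Matrix.conjTranspose_kronecker, ← Matrix.mul_kronecker_mul, ← Matrix.mul_kronecker_mul,
      Matrix.conjTranspose_one, Matrix.one_mul, Matrix.mul_one]
    exact I_pow_smul_mem_pauliGroup
      (joinQubits_kronecker_mem (hU.2 _ (pauliString_mem _)) (pauliString_mem _)) k

/-- Clifford unitaries preserve the set of stabilizer states. -/
theorem IsClifford.conj_mem_stabStates {n : ℕ} {U : QMat n} (hU : IsClifford U) {σ : QMat n}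
    (hσ : σ ∈ stabStates n) : U * σ * Uᴴ ∈ stabStates n := by
  let f : QMat n →ₗ[ℝ] QMat n :=
    LinearMap.mulLeft ℝ U ∘ₗ LinearMap.mulRight ℝ Uᴴ
  have hf (ρ : QMat n) : f ρ = U * ρ * Uᴴ := by simp [f, Matrix.mul_assoc]
  rw [← hf]
  refine convexHull_min (t := f ⁻¹' stabStates n) ?_ ((convex_convexHull ℝ _).linear_preimage f) hσ
  rintro _ ⟨V, hV, rfl⟩
  refine subset_convexHull ℝ _ ⟨U * V, hU.mul hV, ?_⟩
  rw [hf, Matrix.conjTranspose_mul]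
  simp only [Matrix.mul_assoc]

theorem ampliation_sandwich {n : ℕ} {κ : Type*} [Fintype κ] [DecidableEq κ] (U V : QMat n)
    (A : Matrix ((Fin n → Fin 2) × κ) ((Fin n → Fin 2) × κ) ℂ) :
    ampliation (sandwich U V) A = (U ⊗ₖ (1 : Matrix κ κ ℂ)) * A * (V ⊗ₖ (1 : Matrix κ κ ℂ)) := by
  ext ⟨a, k⟩ ⟨b, l⟩
  simp [ampliation, sandwich, Matrix.mul_apply, Fintype.sum_prod_type, Matrix.kroneckerMap_apply,
    Matrix.one_apply, Finset.sum_mul, Finset.mul_sum, mul_assoc]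
  exact Finset.sum_comm

theorem isCPTP_sandwich {n : ℕ} {U : QMat n} (hU : Uᴴ * U = 1) : IsCPTP (sandwich U Uᴴ) := by
  refine ⟨fun k A hA => ?_, fun A => ?_⟩
  · have := hA.mul_mul_conjTranspose_same (U ⊗ₖ (1 : Matrix (Fin k) (Fin k) ℂ))
    rwa [Matrix.conjTranspose_kronecker, Matrix.conjTranspose_one, ← ampliation_sandwich] at this
  · simp only [sandwich, LinearMap.comp_apply, LinearMap.mulLeft_apply, LinearMap.mulRight_apply]
    rw [Matrix.trace_mul_comm, Matrix.mul_assoc, hU, Matrix.mul_one]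

/-- Clifford gates are completely stabilizer-preserving. -/
theorem IsClifford.sandwich_mem_csp {n : ℕ} {U : QMat n} (hU : IsClifford U) :
    sandwich U Uᴴ ∈ csp n := by
  refine ⟨isCPTP_sandwich hU.conjTranspose_mul, fun m σ hσ => ?_⟩
  rw [ampliation_sandwich, joinQubits_mul, joinQubits_mul,
    show Uᴴ ⊗ₖ (1 : QMat m) = (U ⊗ₖ (1 : QMat m))ᴴ by
      rw [Matrix.conjTranspose_kronecker, Matrix.conjTranspose_one], joinQubits_conjTranspose]
  exact hU.kronecker_one.conj_mem_stabStates hσ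

theorem convex_csp (n : ℕ) : Convex ℝ (csp n) := by
  rintro E ⟨⟨hE1, hE2⟩, hE3⟩ F ⟨⟨hF1, hF2⟩, hF3⟩ a b ha hb hab
  refine ⟨⟨fun k A hA => ?_, fun A => ?_⟩, fun m σ hσ => ?_⟩
  · exact ((hE1 k A hA).smul ha).add ((hF1 k A hA).smul hb)
  · rw [LinearMap.add_apply, LinearMap.smul_apply, LinearMap.smul_apply, Matrix.trace_add,
      Matrix.trace_smul, Matrix.trace_smul, hE2, hF2, ← add_smul, hab, one_smul]
  · exact convex_convexHull ℝ _ (hE3 m σ hσ) (hF3 m σ hσ) ha hb hab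

/-- The Choi state, as a linear function of the map. -/
def choiLin (n : ℕ) : SuperOp n →ₗ[ℝ]
    Matrix ((Fin n → Fin 2) × (Fin n → Fin 2)) ((Fin n → Fin 2) × (Fin n → Fin 2)) ℂ where
  toFun := choi
  map_add' _ _ := rfl
  map_smul' _ _ := rfl

/-- The Choi state consists of the images of the matrix units, up to normalization. -/
theorem choi_apply {n : ℕ} (E : SuperOp n) (a k b l : Fin n → Fin 2) :
    choi E (a, k) (b, l) = (2 ^ n : ℂ)⁻¹ * E (Matrix.single k l 1) a b := by
  have h : (Matrix.of fun s t => Matrix.vecMulVec (maxEntangled n) (star (maxEntangled n))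
      (s, k) (t, l)) = (2 ^ n : ℂ)⁻¹ • Matrix.single k l (1 : ℂ) := by
    ext s t
    simp only [Matrix.of_apply, Matrix.vecMulVec_apply, maxEntangled, Pi.star_apply,
      Matrix.smul_apply, Matrix.single_apply, eq_comm (a := k), eq_comm (a := l)]
    have : (((Real.sqrt (2 ^ n))⁻¹ : ℝ) : ℂ) * (((Real.sqrt (2 ^ n))⁻¹ : ℝ) : ℂ) =
        (2 ^ n : ℂ)⁻¹ := by
      rw [← Complex.ofReal_mul, ← mul_inv, Real.mul_self_sqrt (by positivity)]
      push_cast; rfl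
    by_cases h1 : s = k <;> by_cases h2 : t = l <;>
      simp only [h1, h2, if_true, if_false, and_self, and_true, and_false, star_zero, mul_zero,
        zero_mul, smul_eq_mul, mul_one, Complex.star_def, Complex.conj_ofReal, this]
  simp only [choi, ampliation, Matrix.of_apply, h, map_smul, Matrix.smul_apply, smul_eq_mul]

theorem choi_sandwich {n : ℕ} (U V : QMat n) (a k b l : Fin n → Fin 2) :
    choi (sandwich U V) (a, k) (b, l) = (2 ^ n : ℂ)⁻¹ * (U a k * V l b) := by
  rw [choi_apply]
  simp [sandwich, Matrix.mul_apply, Matrix.single_apply, ite_and]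

/-! ### One-qubit operators and the two parity codes -/

/-- The computational basis label of a single qubit. -/
def bit (m : Fin 2) : Fin 1 → Fin 2 := fun _ => m

theorem exists_eq_bit (a : Fin 1 → Fin 2) : ∃ m, a = bit m :=
  ⟨a 0, funext fun i => by rw [Subsingleton.elim i 0]; rfl⟩

theorem bit_inj {m m' : Fin 2} : bit m = bit m' ↔ m = m' :=
  ⟨fun h => congrFun h 0, fun h => h ▸ rfl⟩

theorem sum_bit (f : (Fin 1 → Fin 2) → ℂ) : ∑ a, f a = f (bit 0) + f (bit 1) := by
  rw [← Fin.sum_univ_two (fun m => f (bit m))]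
  exact ((Equiv.funUnique (Fin 1) (Fin 2)).symm.sum_comp f).symm

theorem pauliString_bit (i : Fin 4) (m m' : Fin 2) :
    pauliString ![i] (bit m) (bit m') = pauli i m m' := by
  simp [pauliString, bit]

/-- The two-qubit basis states `|m + b⟩|m⟩`. For `b = 0` and for `b = 1` they span the codes
stabilized by `Z ⊗ Z` and by `-Z ⊗ Z`, each of which encodes one logical qubit. -/
def codeBit (b m : Fin 2) : (Fin 1 → Fin 2) × (Fin 1 → Fin 2) := (bit (m + b), bit m)

theorem exists_eq_codeBit (x : (Fin 1 → Fin 2) × (Fin 1 → Fin 2)) : ∃ b m, x = codeBit b m := by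
  obtain ⟨x, y⟩ := x
  obtain ⟨i, rfl⟩ := exists_eq_bit x
  obtain ⟨j, rfl⟩ := exists_eq_bit y
  exact ⟨i - j, j, by simp [codeBit]⟩

theorem codeBit_inj {b m b' m' : Fin 2} : codeBit b m = codeBit b' m' ↔ b = b' ∧ m = m' := by
  simp only [codeBit, Prod.mk.injEq, bit_inj]
  revert b m b' m'; decide

/-- The operator `(t I + u X + v Y) / 2` on one qubit, where `z = u + i v`. -/
def bloch (t : ℝ) (z : ℂ) : Matrix (Fin 2) (Fin 2) ℂ :=
  (1 / 2 : ℂ) • !![(t : ℂ), star z; z, (t : ℂ)]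

theorem bloch_sub (t t' : ℝ) (z z' : ℂ) : bloch t z - bloch t' z' = bloch (t - t') (z - z') := by
  ext i j
  fin_cases i <;> fin_cases j <;> simp [bloch] <;> ring

theorem smul_bloch (l t : ℝ) (z : ℂ) : l • bloch t z = bloch (l * t) (l * z) := by
  ext i j
  fin_cases i <;> fin_cases j <;> simp [bloch] <;> ring

/-- Operators with a Bloch vector inside the Bloch disc are positive. -/
theorem posSemidef_bloch {t : ℝ} {z : ℂ} (h : ‖z‖ ≤ t) : (bloch t z).PosSemidef := by
  obtain ⟨u, hu, hz⟩ : ∃ u : ℂ, u * star u = 1 ∧ z = ‖z‖ * u := by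
    refine ⟨Complex.exp (z.arg * Complex.I), ?_, (Complex.norm_mul_exp_arg_mul_I z).symm⟩
    rw [Complex.star_def, Complex.mul_conj, Complex.normSq_eq_norm_sq,
      Complex.norm_exp_ofReal_mul_I]
    norm_num
  -- a multiple of the identity plus a multiple of a pure state with Bloch vector `u`
  have key : bloch t z = ((t - ‖z‖) / 2) • (1 : Matrix (Fin 2) (Fin 2) ℂ) +
      (‖z‖ / 2) • Matrix.vecMulVec ![1, u] (star ![1, u]) := by
    generalize ‖z‖ = r at hz
    subst hz
    ext i j
    simp only [bloch, Matrix.add_apply, Matrix.smul_apply, Matrix.vecMulVec_apply, Pi.star_apply]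
    fin_cases i <;> fin_cases j <;> simp <;>
      first | (simp only [Complex.star_def] at hu; linear_combination (-(r : ℂ) / 2) * hu) | ring
  rw [key]
  exact (Matrix.PosSemidef.one.smul (by linarith)).add
    ((Matrix.posSemidef_vecMulVec_self_star _).smul (by positivity))

/-- Conversely to `posSemidef_bloch`, the `XY` part of the Bloch vector of a positive operator is
bounded by its trace. -/
theorem norm_le_of_posSemidef {N : Matrix (Fin 2) (Fin 2) ℂ} (h : N.PosSemidef) :
    ‖2 * N 1 0‖ ≤ (N 0 0 + N 1 1).re := by
  have hdet := h.det_nonneg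
  have h0 := h.diag_nonneg (i := 0)
  have h1 := h.diag_nonneg (i := 1)
  have h01 : N 0 1 = star (N 1 0) := (h.1.apply 0 1).symm
  rw [Matrix.det_fin_two, h01, mul_comm (star _), Complex.star_def, Complex.mul_conj] at hdet
  rw [Complex.le_def] at h0 h1 hdet
  simp only [Complex.zero_re, Complex.zero_im, Complex.sub_re, Complex.mul_re,
    Complex.ofReal_re, Complex.normSq_eq_norm_sq] at h0 h1 hdet
  rw [← h0.2, ← h1.2] at hdet
  rw [norm_mul, Complex.norm_ofNat, Complex.add_re]
  refine abs_le_of_sq_le_sq' ?_ (by linarith [h0.1, h1.1]) |>.2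
  nlinarith [sq_nonneg ((N 0 0).re - (N 1 1).re), hdet.1]

/-! ### The octahedral inequality -/

/-- The cone over the octahedron of single-qubit stabilizer states, for operators without
constraint on their `Z` component: `|⟨X⟩| + |⟨Y⟩| ≤ ⟨I⟩`. -/
def InOctahedralCone (N : Matrix (Fin 2) (Fin 2) ℂ) : Prop :=
  |(2 * N 1 0).re| + |(2 * N 1 0).im| ≤ (N 0 0 + N 1 1).re

theorem convex_inOctahedralCone {ι : Type*} (e : Fin 2 → ι) :
    Convex ℝ {σ : Matrix ι ι ℂ | InOctahedralCone (σ.submatrix e e)} := by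
  intro σ hσ τ hτ a b ha hb _
  simp only [InOctahedralCone, Set.mem_ofPred_eq, Matrix.submatrix_apply, Complex.add_re] at hσ hτ ⊢
  have h1 := abs_add_le (a * (2 * σ (e 1) (e 0)).re) (b * (2 * τ (e 1) (e 0)).re)
  have h2 := abs_add_le (a * (2 * σ (e 1) (e 0)).im) (b * (2 * τ (e 1) (e 0)).im)
  rw [abs_mul, abs_mul, abs_of_nonneg ha, abs_of_nonneg hb] at h1 h2
  have h3 := mul_le_mul_of_nonneg_left hσ ha
  have h4 := mul_le_mul_of_nonneg_left hτ hb
  have e1 : (2 * (a • σ + b • τ) (e 1) (e 0)).re =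
      a * (2 * σ (e 1) (e 0)).re + b * (2 * τ (e 1) (e 0)).re := by
    simp; ring
  have e2 : (2 * (a • σ + b • τ) (e 1) (e 0)).im =
      a * (2 * σ (e 1) (e 0)).im + b * (2 * τ (e 1) (e 0)).im := by
    simp; ring
  rw [e1, e2]
  simp only [Matrix.add_apply, Matrix.smul_apply, Complex.add_re, Complex.real_smul,
    Complex.re_ofReal_mul]
  linarith

theorem opX_mul_opX : opX * opX = 1 := pauliString_mul_self _

theorem opY_mul_opY : opY * opY = 1 := pauliString_mul_self _

theorem qMat_one_ext {A B : QMat 1} (h : ∀ m m', A (bit m) (bit m') = B (bit m) (bit m')) :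
    A = B := by
  ext a b
  obtain ⟨i, rfl⟩ := exists_eq_bit a
  obtain ⟨j, rfl⟩ := exists_eq_bit b
  exact h i j

theorem opX_mul_opY : opX * opY = Complex.I • opZ := by
  refine qMat_one_ext fun m m' => ?_
  simp only [Matrix.mul_apply, sum_bit, opX, opY, opZ, Matrix.smul_apply, pauliString_bit]
  fin_cases m <;> fin_cases m' <;> simp [pauli]

theorem opY_mul_opX : opY * opX = -(Complex.I • opZ) := by
  refine qMat_one_ext fun m m' => ?_
  simp only [Matrix.mul_apply, sum_bit, opX, opY, opZ, Matrix.smul_apply, Matrix.neg_apply,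
    pauliString_bit]
  fin_cases m <;> fin_cases m' <;> simp [pauli]

/-- One qubit is the code with the trivial stabilizer: `G₁ = G₂ = X`, `K₁ = K₂ = Y`, `Q = 1`. -/
theorem inOctahedralCone_of_mem_stabStates_one {σ : QMat 1} (hσ : σ ∈ stabStates 1) :
    InOctahedralCone (σ.submatrix bit bit) := by
  refine convexHull_min ?_ (convex_inOctahedralCone bit) hσ
  intro τ hτ
  have hX : opX ∈ pauliGroup 1 := pauliString_mem _
  have hY : opY ∈ pauliGroup 1 := pauliString_mem _
  have hXY : opX * opY = -(opY * opX) := by rw [opX_mul_opY, opY_mul_opX, neg_neg]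
  have key := abs_add_abs_le_of_mem_pureStabStates hτ hX hX hY hY (one_mem_pauliGroup 1)
    opX_mul_opX opX_mul_opX opY_mul_opY opY_mul_opY opX_mul_opX opX_mul_opX opY_mul_opY opY_mul_opY
    hXY hXY hXY hXY
  have h01 : τ (bit 0) (bit 1) = star (τ (bit 1) (bit 0)) := by
    conv_lhs => rw [← conjTranspose_of_mem_pureStabStates hτ]
    rfl
  have htr := trace_of_mem_pureStabStates hτ
  rw [Matrix.one_mul, htr] at key
  simp only [Matrix.trace, Matrix.diag, Matrix.mul_apply, sum_bit, opX, opY, pauliString_bit, h01]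
    at key htr
  rw [Set.mem_ofPred_eq, InOctahedralCone]
  simp only [Matrix.submatrix_apply, htr]
  generalize τ (bit 1) (bit 0) = w at key ⊢
  simp only [pauli, Complex.add_re, Complex.mul_re, Complex.mul_im] at key ⊢
  simp [abs_mul] at key ⊢
  simp only [← two_mul, abs_mul, abs_two] at key
  linarith

theorem joinQubits_smul {n m : ℕ} (c : ℂ)
    (A : Matrix ((Fin n → Fin 2) × (Fin m → Fin 2)) ((Fin n → Fin 2) × (Fin m → Fin 2)) ℂ) :
    joinQubits (c • A) = c • joinQubits A := rfl

/-- Both diagonal blocks of a two-qubit stabilizer state, with respect to the codes of `codeBit`,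
are unnormalized stabilizer states of the logical qubit, as far as `X` and `Y` are concerned. -/
theorem inOctahedralCone_of_joinQubits_mem_stabStates
    {τ : Matrix ((Fin 1 → Fin 2) × (Fin 1 → Fin 2)) ((Fin 1 → Fin 2) × (Fin 1 → Fin 2)) ℂ}
    (hτ : joinQubits τ ∈ stabStates (1 + 1)) (b : Fin 2) :
    InOctahedralCone (τ.submatrix (codeBit b) (codeBit b)) := by
  let e := fun m => Fin.appendEquiv 1 1 (codeBit b m)
  suffices h : InOctahedralCone ((joinQubits τ).submatrix e e) by
    simpa only [InOctahedralCone, Matrix.submatrix_apply, e, joinQubits_append] using h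
  refine convexHull_min ?_ (convex_inOctahedralCone e) hτ
  intro σ hσ
  obtain ⟨τ, rfl⟩ : ∃ τ, joinQubits τ = σ :=
    (Matrix.reindex (Fin.appendEquiv 1 1) (Fin.appendEquiv 1 1)).surjective σ
  have hX : opX ∈ pauliGroup 1 := pauliString_mem _
  have hY : opY ∈ pauliGroup 1 := pauliString_mem _
  have hZ : opZ ∈ pauliGroup 1 := pauliString_mem _
  obtain ⟨s, hsb, hs⟩ : ∃ s : ℂ, (s = 1 ∧ b = 0 ∨ s = -1 ∧ b = 1) ∧ s * s = 1 := by
    fin_cases b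
    · exact ⟨1, by simp⟩
    · exact ⟨-1, by simp⟩
  have hmem {A : QMat (1 + 1)} (hA : A ∈ pauliGroup (1 + 1)) : s • A ∈ pauliGroup (1 + 1) := by
    rcases hsb with ⟨rfl, -⟩ | ⟨rfl, -⟩
    · simpa using hA
    · simpa using neg_mem_pauliGroup hA
  -- with `s = (-1)ᵇ`, the logical operators of the code stabilized by `s Z ⊗ Z`
  have key := abs_add_abs_le_of_mem_pureStabStates hσ
    (G₁ := joinQubits (opX ⊗ₖ opX)) (G₂ := -(s • joinQubits (opY ⊗ₖ opY)))
    (K₁ := joinQubits (opX ⊗ₖ opY)) (K₂ := s • joinQubits (opY ⊗ₖ opX))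
    (Q := s • joinQubits (opZ ⊗ₖ opZ))
    (joinQubits_kronecker_mem hX hX) (neg_mem_pauliGroup (hmem (joinQubits_kronecker_mem hY hY)))
    (joinQubits_kronecker_mem hX hY) (hmem (joinQubits_kronecker_mem hY hX))
    (hmem (joinQubits_kronecker_mem hZ hZ))
  simp only [Matrix.smul_mul, Matrix.mul_smul, smul_smul, hs,
    ← joinQubits_mul, ← Matrix.mul_kronecker_mul, opX_mul_opX, opY_mul_opY, opX_mul_opY,
    opY_mul_opX, Matrix.one_kronecker_one, joinQubits_one, Matrix.smul_kronecker,
    Matrix.kronecker_smul, joinQubits_smul, Complex.I_mul_I, one_smul, neg_neg,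
    ← neg_smul, mul_neg, neg_mul, mul_one, forall_true_left, trace_joinQubits] at key
  have htr := trace_of_mem_pureStabStates hσ
  have hherm : τᴴ = τ :=
    (Matrix.reindex (Fin.appendEquiv 1 1) (Fin.appendEquiv 1 1)).injective
      (conjTranspose_of_mem_pureStabStates hσ)
  have h01 : τ (codeBit b 0) (codeBit b 1) = star (τ (codeBit b 1) (codeBit b 0)) := by
    conv_lhs => rw [← hherm]
    rfl
  rw [Set.mem_ofPred_eq, InOctahedralCone]
  simp only [Matrix.submatrix_apply, e, joinQubits_append]
  rw [← Complex.one_re, ← htr] at key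
  simp only [Matrix.trace_smul, trace_joinQubits] at key
  simp only [Matrix.trace, Matrix.diag, Matrix.mul_apply,
    Fintype.sum_prod_type, sum_bit, opX, opY, opZ, Matrix.kroneckerMap_apply, pauliString_bit]
    at key
  -- dropping the absolute values keeps the remaining goal linear
  have signs {A B C : ℝ} (h : |A| + |B| ≤ C) :
      A + B ≤ C ∧ A - B ≤ C ∧ -A + B ≤ C ∧ -A - B ≤ C := by
    refine ⟨?_, ?_, ?_, ?_⟩ <;>
      linarith [le_abs_self A, le_abs_self B, neg_abs_le A, neg_abs_le B]
  have hre := congrArg Complex.re h01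
  have him := congrArg Complex.im h01
  rcases hsb with ⟨rfl, rfl⟩ | ⟨rfl, rfl⟩ <;>
  · simp only [codeBit] at hre him ⊢
    simp [pauli] at key hre him ⊢
    obtain ⟨k₁, k₂, k₃, k₄⟩ := signs key
    rcases abs_cases (τ _ _).re with ⟨h, -⟩ | ⟨h, -⟩ <;>
      rcases abs_cases (τ _ _).im with ⟨h', -⟩ | ⟨h', -⟩ <;> rw [h, h'] <;> linarith

/-! ### Block diagonal Choi states of mixtures of Clifford gates -/

/-- The two-qubit operator that is block diagonal with respect to the two codes of `codeBit` and
acts as `N b` on the logical qubit of the code `b`. -/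
def codeMat (N : Fin 2 → Matrix (Fin 2) (Fin 2) ℂ) :
    Matrix ((Fin 1 → Fin 2) × (Fin 1 → Fin 2)) ((Fin 1 → Fin 2) × (Fin 1 → Fin 2)) ℂ :=
  ∑ b, (1 : Matrix _ _ ℂ).submatrix id (codeBit b) * N b *
    ((1 : Matrix _ _ ℂ).submatrix id (codeBit b))ᴴ

theorem codeMat_codeBit (N : Fin 2 → Matrix (Fin 2) (Fin 2) ℂ) (b m b' m' : Fin 2) :
    codeMat N (codeBit b m) (codeBit b' m') = if b = b' then N b m m' else 0 := by
  rw [codeMat, Matrix.sum_apply]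
  simp only [Matrix.mul_apply, Matrix.conjTranspose_apply, Matrix.submatrix_apply, id,
    Matrix.one_apply, codeBit_inj]
  fin_cases b <;> fin_cases b' <;> fin_cases m <;> fin_cases m' <;> simp

theorem ext_codeBit
    {A B : Matrix ((Fin 1 → Fin 2) × (Fin 1 → Fin 2)) ((Fin 1 → Fin 2) × (Fin 1 → Fin 2)) ℂ}
    (h : ∀ b m b' m', A (codeBit b m) (codeBit b' m') = B (codeBit b m) (codeBit b' m')) :
    A = B := by
  ext x y
  obtain ⟨b, m, rfl⟩ := exists_eq_codeBit x
  obtain ⟨b', m', rfl⟩ := exists_eq_codeBit y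
  exact h b m b' m'

theorem posSemidef_codeMat {N : Fin 2 → Matrix (Fin 2) (Fin 2) ℂ} (h : ∀ b, (N b).PosSemidef) :
    (codeMat N).PosSemidef :=
  Matrix.posSemidef_sum _ fun b _ => (h b).mul_mul_conjTranspose_same _

theorem codeMat_sub (N N' : Fin 2 → Matrix (Fin 2) (Fin 2) ℂ) :
    codeMat N - codeMat N' = codeMat fun b => N b - N' b := by
  refine ext_codeBit fun b m b' m' => ?_
  simp only [Matrix.sub_apply, codeMat_codeBit]
  split_ifs <;> simp

theorem smul_codeMat (l : ℝ) (N : Fin 2 → Matrix (Fin 2) (Fin 2) ℂ) :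
    l • codeMat N = codeMat fun b => l • N b := by
  refine ext_codeBit fun b m b' m' => ?_
  simp only [Matrix.smul_apply, codeMat_codeBit]
  split_ifs <;> simp

theorem submatrix_codeMat (N : Fin 2 → Matrix (Fin 2) (Fin 2) ℂ) (b : Fin 2) :
    (codeMat N).submatrix (codeBit b) (codeBit b) = N b := by
  ext m m'
  simp [codeMat_codeBit]

/-- The phase gate `diag(1, i)`. -/
def phaseGate : QMat 1 := Matrix.of fun a b => if a = b then Complex.I ^ (a 0 : ℕ) else 0

theorem phaseGate_bit (m m' : Fin 2) :
    phaseGate (bit m) (bit m') = if m = m' then Complex.I ^ (m : ℕ) else 0 := by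
  simp [phaseGate, bit_inj]
  rfl

theorem isClifford_phaseGate : IsClifford phaseGate := by
  -- the phase of the prefactor is chosen so that the upper left entry is `1`
  have h : phaseGate = ((1 + Complex.I) / 2) • (1 + -(Complex.I • opZ)) := by
    refine qMat_one_ext fun m m' => ?_
    simp only [phaseGate_bit, Matrix.smul_apply, Matrix.add_apply, Matrix.neg_apply, opZ,
      pauliString_bit, Matrix.one_apply, bit_inj]
    fin_cases m <;> fin_cases m' <;> simp [pauli]
    · linear_combination (1 / 2) * Complex.I_mul_I
    · linear_combination (-1 / 2) * Complex.I_mul_I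
  have hZ : -(Complex.I • opZ) ∈ pauliGroup 1 :=
    neg_mem_pauliGroup ⟨1, ![3], by rw [pow_one]; rfl⟩
  rw [h]
  refine isClifford_smul_add (one_mem_pauliGroup 1) hZ ?_ ?_
  · simp [Matrix.conjTranspose_smul, opZ, pauliString_conjTranspose]
  · simp
    linear_combination (-1 / 4) * Complex.I_mul_I

theorem IsClifford.pow {n : ℕ} {U : QMat n} (hU : IsClifford U) (k : ℕ) : IsClifford (U ^ k) := by
  induction k with
  | zero => simpa using isClifford_of_mem_pauliGroup (one_mem_pauliGroup n)
  | succ k ih => rw [pow_succ]; exact ih.mul hU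

theorem phaseGate_pow_bit (k : ℕ) (m m' : Fin 2) :
    (phaseGate ^ k) (bit m) (bit m') = if m = m' then (Complex.I ^ k) ^ (m : ℕ) else 0 := by
  have h : phaseGate = Matrix.diagonal fun a => Complex.I ^ (a 0 : ℕ) := by
    ext a b
    simp [phaseGate, Matrix.diagonal_apply]
  rw [h, Matrix.diagonal_pow, Matrix.diagonal_apply]
  simp only [bit_inj, Pi.pow_apply, ← pow_mul, mul_comm]
  rfl

/-- The Clifford gates `Xᵇ diag(1, iʲ)`. -/
def cliffordGate (b : Fin 2) (j : Fin 4) : QMat 1 := opX ^ (b : ℕ) * phaseGate ^ (j : ℕ)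

theorem isClifford_cliffordGate (b : Fin 2) (j : Fin 4) : IsClifford (cliffordGate b j) :=
  ((isClifford_of_mem_pauliGroup (pauliString_mem _)).pow _).mul (isClifford_phaseGate.pow _)

theorem cliffordGate_bit (b : Fin 2) (j : Fin 4) (m m' : Fin 2) :
    cliffordGate b j (bit m) (bit m') =
      if m = m' + b then (Complex.I ^ (j : ℕ)) ^ (m' : ℕ) else 0 := by
  simp only [cliffordGate, Matrix.mul_apply, sum_bit, phaseGate_pow_bit]
  fin_cases b <;> fin_cases m <;> fin_cases m' <;>
    simp [opX, pauliString_bit, pauli, bit_inj]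

theorem bloch_one_apply {u : ℂ} (hu : u * star u = 1) (m m' : Fin 2) :
    bloch 1 u m m' = 1 / 2 * (u ^ (m : ℕ) * star (u ^ (m' : ℕ))) := by
  fin_cases m <;> fin_cases m' <;> simp [bloch]
  simpa using hu

theorem I_pow_mul_star (j : ℕ) : Complex.I ^ j * star (Complex.I ^ j) = 1 := by
  simp [← mul_pow]

/-- The Choi state of `Xᵇ diag(1, iʲ)` is the equatorial stabilizer state with Bloch vector `iʲ`,
encoded in the code `b`. -/
theorem choi_cliffordGate (b : Fin 2) (j : Fin 4) (c m c' m' : Fin 2) :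
    choi (sandwich (cliffordGate b j) (cliffordGate b j)ᴴ) (codeBit c m) (codeBit c' m') =
      if c = b ∧ c' = b then bloch 1 (Complex.I ^ (j : ℕ)) m m' else 0 := by
  rw [codeBit, codeBit, choi_sandwich, Matrix.conjTranspose_apply, cliffordGate_bit,
    cliffordGate_bit, bloch_one_apply (I_pow_mul_star _)]
  simp only [add_right_inj]
  by_cases h : c = b <;> by_cases h' : c' = b <;> simp [h, h']

/-- The octahedron's equatorial square is the convex hull of its vertices `1`, `i`, `-1`, `-i`. -/
theorem exists_weights {t : ℝ} {z : ℂ} (h : |z.re| + |z.im| ≤ t) :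
    ∃ w : Fin 4 → ℝ, (∀ j, 0 ≤ w j) ∧ ∑ j, w j = t ∧
      ∑ j, w j • bloch 1 (Complex.I ^ (j : ℕ)) = bloch t z := by
  set d := (t - |z.re| - |z.im|) / 4 with hd
  have hd0 : 0 ≤ d := by rw [hd]; linarith
  have hz := Complex.re_add_im z
  have hsum : (|z.re| + z.re) / 2 + d + ((|z.im| + z.im) / 2 + d) + ((|z.re| - z.re) / 2 + d) +
      ((|z.im| - z.im) / 2 + d) = t := by rw [hd]; ring
  refine ⟨![(|z.re| + z.re) / 2 + d, (|z.im| + z.im) / 2 + d, (|z.re| - z.re) / 2 + d,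
    (|z.im| - z.im) / 2 + d], fun j => ?_, ?_, ?_⟩
  · fin_cases j <;> simp <;>
      linarith [le_abs_self z.re, neg_abs_le z.re, le_abs_self z.im, neg_abs_le z.im]
  · simpa [Fin.sum_univ_four] using hsum
  · have hsumC := congrArg (fun r : ℝ => (r : ℂ)) hsum
    have hz' : starRingEnd ℂ z = z.re - z.im * Complex.I := by
      conv_lhs => rw [← hz]
      simp only [map_add, map_mul, Complex.conj_ofReal, Complex.conj_I]
      ring
    ext m m'
    simp only [Matrix.sum_apply, Fin.sum_univ_four, Matrix.smul_apply, bloch, Complex.real_smul]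
    push_cast at hsumC
    fin_cases m <;> fin_cases m' <;> simp [pow_succ]
    · linear_combination (1 / 2) * hsumC
    · rw [hz']; ring
    · conv_rhs => rw [← hz]
      ring
    · linear_combination (1 / 2) * hsumC

/-- Every block diagonal state whose blocks lie in the equatorial square of the octahedron is the
Choi state of a mixture of Clifford gates. -/
theorem exists_csp_choi_eq {t : Fin 2 → ℝ} {z : Fin 2 → ℂ}
    (h : ∀ b, |(z b).re| + |(z b).im| ≤ t b) (ht : ∑ b, t b = 1) :
    ∃ M ∈ csp 1, choi M = codeMat fun b => bloch (t b) (z b) := by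
  choose w hw0 hw1 hw using fun b => exists_weights (h b)
  let E (x : Fin 2 × Fin 4) : SuperOp 1 :=
    sandwich (cliffordGate x.1 x.2) (cliffordGate x.1 x.2)ᴴ
  refine ⟨∑ x : Fin 2 × Fin 4, w x.1 x.2 • E x, ?_, ?_⟩
  · refine (convex_csp 1).sum_mem (fun x _ => hw0 x.1 x.2) ?_ fun x _ =>
      (isClifford_cliffordGate _ _).sandwich_mem_csp
    rw [Fintype.sum_prod_type]
    simp only [hw1, ht]
  · have hlin : choi (∑ x : Fin 2 × Fin 4, w x.1 x.2 • E x) =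
        ∑ x : Fin 2 × Fin 4, w x.1 x.2 • choi (E x) := by
      change choiLin 1 _ = ∑ x, _ • choiLin 1 _
      simp only [map_sum, map_smul]
    rw [hlin]
    refine ext_codeBit fun c m c' m' => ?_
    simp only [Matrix.sum_apply, Matrix.smul_apply, E, choi_cliffordGate, codeMat_codeBit,
      Fintype.sum_prod_type]
    rw [← hw c, Matrix.sum_apply, Finset.sum_eq_single c]
    · by_cases hc : c = c'
      · simp [hc]
      · simp [hc, Ne.symm hc]
    · intro b _ hb
      simp [Ne.symm hb]
    · simp

/-- The unnormalized form of `exists_csp_choi_eq`; it includes the zero operator, for which any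
channel will do. -/
theorem exists_csp_smul_choi_eq {t : Fin 2 → ℝ} {z : Fin 2 → ℂ}
    (h : ∀ b, |(z b).re| + |(z b).im| ≤ t b) :
    ∃ M ∈ csp 1, (∑ b, t b) • choi M = codeMat fun b => bloch (t b) (z b) := by
  have ht (b) : 0 ≤ t b := le_trans (by positivity) (h b)
  rcases (Finset.sum_nonneg fun b _ => ht b).eq_or_lt' with h0 | hpos
  · obtain ⟨M, hM, -⟩ := exists_csp_choi_eq (t := fun _ => 1 / 2) (z := 0) (by simp) (by simp)
    refine ⟨M, hM, ?_⟩
    have ht0 (b) : t b = 0 := (Finset.sum_eq_zero_iff_of_nonneg fun b _ => ht b).1 h0 b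
      (Finset.mem_univ b)
    have hz0 (b) : z b = 0 := by
      have := h b
      rw [ht0] at this
      exact Complex.ext (abs_nonpos_iff.1 (by linarith [abs_nonneg (z b).im]))
        (abs_nonpos_iff.1 (by linarith [abs_nonneg (z b).re]))
    rw [h0, zero_smul]
    refine ext_codeBit fun b m b' m' => ?_
    rw [codeMat_codeBit, ht0, hz0]
    fin_cases m <;> fin_cases m' <;> simp [bloch]
  · set l := ∑ b, t b
    obtain ⟨M, hM, hJ⟩ := exists_csp_choi_eq (t := fun b => l⁻¹ * t b)
      (z := fun b => ((l⁻¹ : ℝ) : ℂ) * z b) (fun b => by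
        rw [Complex.re_ofReal_mul, Complex.im_ofReal_mul, abs_mul, abs_mul,
          abs_of_pos (inv_pos.2 hpos), ← mul_add]
        exact mul_le_mul_of_nonneg_left (h b) (inv_pos.2 hpos).le)
      (by rw [← Finset.mul_sum, inv_mul_cancel₀ hpos.ne'])
    refine ⟨M, hM, ?_⟩
    rw [hJ, smul_codeMat]
    simp only [smul_bloch, ← mul_assoc, ← Complex.ofReal_mul, mul_inv_cancel₀ hpos.ne', one_mul,
      Complex.ofReal_one]

/-! ### Equatorial stabilizer states and the maximally entangled state -/

/-- An operator on one qubit, with the basis labelled by `Fin 1 → Fin 2`. -/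
def toQubit (N : Matrix (Fin 2) (Fin 2) ℂ) : QMat 1 := N.submatrix (fun a => a 0) fun a => a 0

theorem toQubit_bit (N : Matrix (Fin 2) (Fin 2) ℂ) (m m' : Fin 2) :
    toQubit N (bit m) (bit m') = N m m' := rfl

theorem mul_single_mul_conjTranspose_apply {n : ℕ} (U : QMat n) (a b : Fin n → Fin 2) :
    (U * Matrix.single 0 0 1 * Uᴴ : QMat n) a b = U a 0 * star (U b 0) := by
  simp [Matrix.mul_apply, Matrix.single_apply, ite_and]

theorem sqrt_two_inv_mul_self : ((Real.sqrt 2)⁻¹ : ℂ) * ((Real.sqrt 2)⁻¹ : ℂ) = 1 / 2 := by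
  rw [← mul_inv, ← Complex.ofReal_mul, Real.mul_self_sqrt (by norm_num)]
  norm_num

theorem isClifford_hadamard : IsClifford ((((Real.sqrt 2)⁻¹ : ℝ) : ℂ) • (opZ + opX)) := by
  refine isClifford_smul_add (pauliString_mem _) (pauliString_mem _) ?_ ?_
  · rw [pauliString_conjTranspose, pauliString_conjTranspose]
    refine qMat_one_ext fun m m' => ?_
    simp only [Matrix.add_apply, Matrix.mul_apply, sum_bit, pauliString_bit]
    fin_cases m <;> fin_cases m' <;> simp [pauli]
  · rw [Complex.star_def, Complex.conj_ofReal]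
    push_cast
    exact sqrt_two_inv_mul_self

/-- The equatorial pure stabilizer states: a Hadamard gate followed by powers of the phase gate. -/
theorem toQubit_bloch_I_pow_mem (j : Fin 4) :
    toQubit (bloch 1 (Complex.I ^ (j : ℕ))) ∈ stabStates 1 := by
  refine subset_convexHull ℝ _ ⟨_, (isClifford_cliffordGate 0 j).mul isClifford_hadamard, ?_⟩
  refine qMat_one_ext fun m m' => ?_
  have h (m : Fin 2) : (cliffordGate 0 j * ((((Real.sqrt 2)⁻¹ : ℝ) : ℂ) • (opZ + opX)))
      (bit m) 0 = ((Real.sqrt 2)⁻¹ : ℂ) * (Complex.I ^ (j : ℕ)) ^ (m : ℕ) := by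
    rw [show (0 : Fin 1 → Fin 2) = bit 0 from rfl]
    simp only [Matrix.mul_apply, sum_bit, cliffordGate_bit, Matrix.smul_apply, Matrix.add_apply,
      opZ, opX, pauliString_bit]
    fin_cases m <;> simp [pauli, mul_comm]
  rw [toQubit_bit, mul_single_mul_conjTranspose_apply, h, h, bloch_one_apply (I_pow_mul_star _),
    ← sqrt_two_inv_mul_self]
  simp
  ring

/-- Every point of the cone over the equatorial square is a multiple of a stabilizer state; if it is
zero, any stabilizer state will do. -/
theorem exists_stabStates_smul_eq {t : ℝ} {z : ℂ} (h : |z.re| + |z.im| ≤ t) :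
    ∃ σ ∈ stabStates 1, t • σ = toQubit (bloch t z) := by
  have ht : 0 ≤ t := le_trans (by positivity) h
  rcases ht.eq_or_lt' with rfl | hpos
  · have hz : z = 0 := Complex.ext (abs_nonpos_iff.1 (by linarith [abs_nonneg z.im]))
      (abs_nonpos_iff.1 (by linarith [abs_nonneg z.re]))
    refine ⟨_, toQubit_bloch_I_pow_mem 0, ?_⟩
    refine qMat_one_ext fun m m' => ?_
    rw [toQubit_bit, hz, zero_smul]
    fin_cases m <;> fin_cases m' <;> simp [bloch]
  · obtain ⟨w, hw0, hw1, hw⟩ := exists_weights h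
    refine ⟨∑ j, (t⁻¹ * w j) • toQubit (bloch 1 (Complex.I ^ (j : ℕ))),
      (convex_convexHull ℝ _).sum_mem (fun j _ => mul_nonneg (inv_pos.2 hpos).le (hw0 j)) ?_
        fun j _ => toQubit_bloch_I_pow_mem j, ?_⟩
    · rw [← Finset.mul_sum, hw1, inv_mul_cancel₀ hpos.ne']
    · simp only [Finset.smul_sum, smul_smul, mul_inv_cancel_left₀ hpos.ne', ← hw]
      ext a b
      simp [Matrix.sum_apply, toQubit]

/-- The maximally entangled state of two qubits is a stabilizer state: the vector is obtained from
`|00⟩` by the Clifford gate `(Z ⊗ 1 + X ⊗ X) / √2`. -/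
theorem joinQubits_maxEntangled_mem :
    joinQubits (Matrix.vecMulVec (maxEntangled 1) (star (maxEntangled 1))) ∈
      stabStates (1 + 1) := by
  have hZ : opZ ∈ pauliGroup 1 := pauliString_mem _
  have hX : opX ∈ pauliGroup 1 := pauliString_mem _
  set W : Matrix ((Fin 1 → Fin 2) × (Fin 1 → Fin 2)) ((Fin 1 → Fin 2) × (Fin 1 → Fin 2)) ℂ :=
    (((Real.sqrt 2)⁻¹ : ℝ) : ℂ) • (opZ ⊗ₖ 1 + opX ⊗ₖ opX) with hWdef
  have hW : IsClifford (joinQubits W) := by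
    refine isClifford_smul_add (joinQubits_kronecker_mem hZ (one_mem_pauliGroup 1))
      (joinQubits_kronecker_mem hX hX) ?_ ?_
    · have hZX : opZ * opX = -(opX * opZ) := by
        refine qMat_one_ext fun m m' => ?_
        simp only [Matrix.neg_apply, Matrix.mul_apply, sum_bit, opX, opZ, pauliString_bit]
        fin_cases m <;> fin_cases m' <;> simp [pauli]
      rw [← joinQubits_conjTranspose, ← joinQubits_conjTranspose, ← joinQubits_mul,
        ← joinQubits_mul, Matrix.conjTranspose_kronecker, Matrix.conjTranspose_kronecker,
        ← Matrix.mul_kronecker_mul, ← Matrix.mul_kronecker_mul,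
        show opXᴴ = opX from pauliString_conjTranspose _,
        show opZᴴ = opZ from pauliString_conjTranspose _, Matrix.conjTranspose_one,
        Matrix.one_mul, Matrix.mul_one, hZX, ← neg_one_smul ℂ, Matrix.smul_kronecker,
        joinQubits_smul, neg_one_smul]
      exact neg_add_cancel _
    · rw [Complex.star_def, Complex.conj_ofReal]
      push_cast
      exact sqrt_two_inv_mul_self
  refine subset_convexHull ℝ _ ⟨_, hW, ?_⟩
  ext a b
  obtain ⟨x, rfl⟩ := (Fin.appendEquiv 1 1).surjective a
  obtain ⟨y, rfl⟩ := (Fin.appendEquiv 1 1).surjective b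
  have h0 : (0 : Fin (1 + 1) → Fin 2) = Fin.appendEquiv 1 1 (bit 0, bit 0) := by
    ext i; fin_cases i <;> rfl
  have h (x) : W x (bit 0, bit 0) = maxEntangled 1 x := by
    obtain ⟨x, y⟩ := x
    obtain ⟨i, rfl⟩ := exists_eq_bit x
    obtain ⟨j, rfl⟩ := exists_eq_bit y
    simp only [hWdef, maxEntangled, Matrix.smul_apply, Matrix.add_apply,
      Matrix.kroneckerMap_apply, opX, opZ, pauliString_bit, Matrix.one_apply, bit_inj]
    fin_cases i <;> fin_cases j <;> simp [pauli]
  rw [mul_single_mul_conjTranspose_apply, h0]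
  simp only [joinQubits_append, h]
  rfl

theorem inOctahedralCone_choi {M : SuperOp 1} (hM : M ∈ csp 1) (b : Fin 2) :
    InOctahedralCone ((choi M).submatrix (codeBit b) (codeBit b)) :=
  inOctahedralCone_of_joinQubits_mem_stabStates (hM.2 1 _ joinQubits_maxEntangled_mem) b

/-! ### The planar optimization problems -/

/-- The robustness of the state with Bloch vector `(x, y, 0)`, for `0 ≤ y ≤ x`. -/
def robXY (x y : ℝ) : ℝ := if y ≤ 1 - x then 1 else (Real.sqrt 2 + x + y) / (Real.sqrt 2 + 1)

/-- The weight of the state with Bloch vector `(x, y, 0)`, for `0 ≤ y ≤ x`. -/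
def weightXY (x y : ℝ) : ℝ :=
  if y ≤ 1 - x then 1
  else if y ≤ (Real.sqrt 2 + 1) * (1 - x) then (Real.sqrt 2 - (x + y)) / (Real.sqrt 2 - 1)
  else (1 - (x ^ 2 + y ^ 2)) / (2 * (1 - x))

/-- The Cauchy–Schwarz inequality in the plane, with the lengths bounded by `A` and `r`. -/
theorem le_mul_of_sq_add_sq_le {a b A u v r : ℝ} (hA : 0 ≤ A) (hab : a ^ 2 + b ^ 2 = A ^ 2)
    (hr : 0 ≤ r) (huv : u ^ 2 + v ^ 2 ≤ r ^ 2) : a * u + b * v ≤ A * r := by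
  refine abs_le_of_sq_le_sq' ?_ (mul_nonneg hA hr) |>.2
  calc (a * u + b * v) ^ 2 ≤ (a ^ 2 + b ^ 2) * (u ^ 2 + v ^ 2) := by
        linarith [sq_nonneg (a * v - b * u)]
    _ ≤ A ^ 2 * r ^ 2 := by rw [hab]; gcongr
    _ = (A * r) ^ 2 := by ring

theorem one_lt_sqrt_two : 1 < Real.sqrt 2 := by
  rw [Real.lt_sqrt (by norm_num)]; norm_num

theorem sq_sqrt_two : Real.sqrt 2 ^ 2 = 2 := Real.sq_sqrt (by norm_num)

/-- A point `(u, v)` of the square of radius `R` at distance at most `R - 1` from `(x, y)`. -/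
theorem robXY_feasible {x y : ℝ} (hy : 0 ≤ y) (hyx : y ≤ x) (hxy : x ^ 2 + y ^ 2 ≤ 1) :
    ∃ u v : ℝ, |u| + |v| ≤ robXY x y ∧ 1 ≤ robXY x y ∧
      (u - x) ^ 2 + (v - y) ^ 2 ≤ (robXY x y - 1) ^ 2 := by
  have h1 := one_lt_sqrt_two
  have h2 := sq_sqrt_two
  have hx : 0 ≤ x := hy.trans hyx
  rw [robXY]
  split_ifs with h
  · exact ⟨x, y, by rw [abs_of_nonneg hx, abs_of_nonneg hy]; linarith, le_rfl, by simp⟩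
  · push Not at h
    set s := Real.sqrt 2
    set R := (s + x + y) / (s + 1) with hR
    have hR1 : R * (s + 1) = s + x + y := div_mul_cancel₀ _ (by linarith)
    have hR2 : 1 ≤ R := by rw [hR, le_div_iff₀ (by linarith)]; linarith
    -- the difference of Bloch vectors points along the direction `-(1, 1)`
    have hx1 : x ≤ 1 := by nlinarith
    have hd : s * (R - 1) / 2 ≤ y := by nlinarith
    refine ⟨x - s * (R - 1) / 2, y - s * (R - 1) / 2, ?_, hR2, ?_⟩
    · rw [abs_of_nonneg (by linarith), abs_of_nonneg (by linarith)]
      nlinarith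
    · apply le_of_eq
      linear_combination (R - 1) ^ 2 / 2 * h2

/-- The dual bound for the robustness, by the witness `√2 I + X + Y`. -/
theorem mul_robXY_le {x y q t u v : ℝ} (ht : |u| + |v| ≤ t) (hqt : q ≤ t)
    (h : (u - q * x) ^ 2 + (v - q * y) ^ 2 ≤ (t - q) ^ 2) : q * robXY x y ≤ t := by
  have h1 := one_lt_sqrt_two
  rw [robXY]
  split_ifs
  · linarith
  · have key := le_mul_of_sq_add_sq_le (a := -1) (b := -1) (A := Real.sqrt 2) (by positivity)
      (by rw [sq_sqrt_two]; norm_num) (sub_nonneg.2 hqt) h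
    rw [← mul_div_assoc, div_le_iff₀ (by linarith)]
    linarith [le_abs_self u, le_abs_self v]

/-- A point `(u, v)` of the square of radius `W` at distance at most `1 - W` from `(x, y)`. -/
theorem weightXY_feasible {x y : ℝ} (hy : 0 ≤ y) (hyx : y ≤ x) (hxy : x ^ 2 + y ^ 2 ≤ 1) :
    ∃ u v : ℝ, |u| + |v| ≤ weightXY x y ∧ weightXY x y ≤ 1 ∧
      (x - u) ^ 2 + (y - v) ^ 2 ≤ (1 - weightXY x y) ^ 2 := by
  have h1 := one_lt_sqrt_two
  have h2 := sq_sqrt_two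
  have hx : 0 ≤ x := hy.trans hyx
  rw [weightXY]
  split_ifs with h h'
  · exact ⟨x, y, by rw [abs_of_nonneg hx, abs_of_nonneg hy]; linarith, le_rfl, by simp⟩
  · push Not at h
    set s := Real.sqrt 2
    set W := (s - (x + y)) / (s - 1) with hW
    have hW1 : W * (s - 1) = s - (x + y) := div_mul_cancel₀ _ (by linarith)
    have hW2 : W ≤ 1 := by rw [hW, div_le_iff₀ (by linarith)]; linarith
    -- the difference of Bloch vectors points along the direction `(1, 1)`
    have hd : s * (1 - W) / 2 ≤ y := by nlinarith
    refine ⟨x - s * (1 - W) / 2, y - s * (1 - W) / 2, ?_, hW2, ?_⟩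
    · rw [abs_of_nonneg (by linarith), abs_of_nonneg (by linarith)]
      nlinarith
    · apply le_of_eq
      linear_combination (1 - W) ^ 2 / 2 * h2
  · push Not at h h'
    have hx1 : 0 < 1 - x := by nlinarith
    set W := (1 - (x ^ 2 + y ^ 2)) / (2 * (1 - x)) with hW
    have hW1 : W * (2 * (1 - x)) = 1 - (x ^ 2 + y ^ 2) := div_mul_cancel₀ _ (by linarith)
    have hW0 : 0 ≤ W := div_nonneg (by linarith) (by linarith)
    have hW2 : W ≤ 1 := by
      rw [hW, div_le_iff₀ (by linarith)]; nlinarith [sq_nonneg (1 - x)]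
    -- here `|+⟩` alone is the optimal stabilizer state
    refine ⟨W, 0, by simp [abs_of_nonneg hW0], hW2, ?_⟩
    apply le_of_eq
    linear_combination hW1

/-- The dual bound for the weight, by the witness `√2 I - X - Y` where the optimal stabilizer state
mixes `|+⟩` and `|+i⟩`, and by the projection orthogonal to the remainder where it is `|+⟩`. -/
theorem le_mul_weightXY {x y q t u v : ℝ} (hy : 0 ≤ y) (hyx : y ≤ x) (hxy : x ^ 2 + y ^ 2 ≤ 1)
    (ht : |u| + |v| ≤ t) (hqt : t ≤ q)
    (h : (q * x - u) ^ 2 + (q * y - v) ^ 2 ≤ (q - t) ^ 2) : t ≤ q * weightXY x y := by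
  have h1 := one_lt_sqrt_two
  have h2 := sq_sqrt_two
  rw [weightXY]
  split_ifs with hc hc'
  · linarith
  · have key := le_mul_of_sq_add_sq_le (a := 1) (b := 1) (A := Real.sqrt 2) (by positivity)
      (by rw [sq_sqrt_two]; norm_num) (sub_nonneg.2 hqt) h
    rw [← mul_div_assoc, le_div_iff₀ (by linarith)]
    linarith [le_abs_self u, le_abs_self v]
  · push Not at hc hc'
    have hx1 : 0 < 1 - x := by nlinarith
    set W := (1 - (x ^ 2 + y ^ 2)) / (2 * (1 - x)) with hW
    have hW1 : W * (2 * (1 - x)) = 1 - (x ^ 2 + y ^ 2) := div_mul_cancel₀ _ (by linarith)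
    have hW2 : W ≤ 1 := by
      rw [hW, div_le_iff₀ (by linarith)]; nlinarith [sq_nonneg (1 - x)]
    -- the witness is orthogonal to the pure remainder, whose Bloch vector is along `(x - W, y)`
    have hB : y ≤ x - W := by
      have hsq : 0 ≤ (y - (1 - x)) ^ 2 - 2 * (1 - x) ^ 2 := by
        nlinarith [mul_pos hx1 (by linarith : (0 : ℝ) < Real.sqrt 2)]
      nlinarith
    have key := le_mul_of_sq_add_sq_le (a := x - W) (b := y) (A := 1 - W) (by linarith)
      (by linear_combination hW1) (sub_nonneg.2 hqt) h
    have hu : (x - W) * u + y * v ≤ (x - W) * t := by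
      have hu1 := mul_le_mul_of_nonneg_left (le_abs_self u) (hy.trans hB)
      have hv1 := mul_le_mul_of_nonneg_left (le_abs_self v) hy
      have hv2 := mul_le_mul_of_nonneg_right hB (abs_nonneg v)
      have ht' := mul_le_mul_of_nonneg_left ht (hy.trans hB)
      linarith
    refine le_of_mul_le_mul_right ?_ hx1
    have hW1' : y ^ 2 = 1 - x ^ 2 - W * (2 * (1 - x)) := by linarith
    have e : (x - W) * (q * x) + y * (q * y) = q * ((x - W) * x + y ^ 2) := by ring
    rw [hW1'] at e
    linarith

theorem exists_sign (c : ℝ) : ∃ s : ℝ, |s| = 1 ∧ c = s * |c| := by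
  rcases le_total 0 c with h | h
  · exact ⟨1, by simp, by rw [abs_of_nonneg h, one_mul]⟩
  · exact ⟨-1, by simp, by rw [abs_of_nonpos h]; ring⟩

/-! ### Robustness and weight formulas in terms of Bloch vectors -/

/-- The complex number `cos θ + i sin θ`, the direction of the Bloch vector of the rotated `|+⟩`. -/
def phase (θ : ℝ) : ℂ := ⟨Real.cos θ, Real.sin θ⟩

variable {θ p : ℝ}

theorem xy_bounds (hθ0 : 0 ≤ θ) (hθ1 : θ ≤ Real.pi / 4) (hp0 : 0 ≤ p) (hp1 : p ≤ 1) :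
    0 ≤ |1 - 2 * p| * Real.sin θ ∧ |1 - 2 * p| * Real.sin θ ≤ |1 - 2 * p| * Real.cos θ ∧
      (|1 - 2 * p| * Real.cos θ) ^ 2 + (|1 - 2 * p| * Real.sin θ) ^ 2 ≤ 1 := by
  have hpi := Real.pi_pos
  have hs : 0 ≤ Real.sin θ := Real.sin_nonneg_of_nonneg_of_le_pi hθ0 (by linarith)
  have hsc : Real.sin θ ≤ Real.cos θ := by
    rw [← Real.sin_pi_div_two_sub]
    exact Real.sin_le_sin_of_le_of_le_pi_div_two (by linarith) (by linarith) (by linarith)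
  refine ⟨by positivity, by gcongr, ?_⟩
  have hc : |1 - 2 * p| ≤ 1 := abs_le.2 ⟨by linarith, by linarith⟩
  calc _ = |1 - 2 * p| ^ 2 * (Real.sin θ ^ 2 + Real.cos θ ^ 2) := by ring
    _ ≤ 1 := by
      rw [Real.sin_sq_add_cos_sq, mul_one]
      exact pow_le_one₀ (abs_nonneg _) hc

theorem norm_le_iff_sq {z : ℂ} {r : ℝ} (hr : 0 ≤ r) : ‖z‖ ≤ r ↔ z.re ^ 2 + z.im ^ 2 ≤ r ^ 2 := by
  rw [← sq_le_sq₀ (norm_nonneg z) hr, Complex.sq_norm, Complex.normSq_apply, sq z.re, sq z.im]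

theorem robFormula_feasible (hθ0 : 0 ≤ θ) (hθ1 : θ ≤ Real.pi / 4) (hp0 : 0 ≤ p) (hp1 : p ≤ 1) :
    1 ≤ robFormula θ p ∧ ∃ ζ : ℂ, |ζ.re| + |ζ.im| ≤ robFormula θ p ∧
      ‖ζ - ((1 - 2 * p : ℝ) : ℂ) * phase θ‖ ≤ robFormula θ p - 1 := by
  obtain ⟨hy, hyx, hxy⟩ := xy_bounds hθ0 hθ1 hp0 hp1
  obtain ⟨u, v, h1, h2, h3⟩ := robXY_feasible hy hyx hxy
  obtain ⟨s, hs, hc⟩ := exists_sign (1 - 2 * p)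
  have hs2 : s ^ 2 = 1 := by rw [← sq_abs, hs]; norm_num
  change 1 ≤ robXY _ _ ∧ ∃ ζ : ℂ, |ζ.re| + |ζ.im| ≤ robXY _ _ ∧ _ ≤ robXY _ _ - 1
  refine ⟨h2, ⟨s * u, s * v⟩, by simpa [abs_mul, hs] using h1, ?_⟩
  rw [norm_le_iff_sq (by linarith)]
  refine le_trans (le_of_eq ?_) h3
  rw [hc]
  simp only [Complex.sub_re, Complex.sub_im, Complex.re_ofReal_mul, Complex.im_ofReal_mul, phase,
    abs_mul, hs, abs_abs, one_mul]
  linear_combination ((u - |1 - 2 * p| * Real.cos θ) ^ 2 + (v - |1 - 2 * p| * Real.sin θ) ^ 2) * hs2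

theorem mul_robFormula_le {q t : ℝ} {ζ : ℂ} (ht : |ζ.re| + |ζ.im| ≤ t)
    (h : ‖ζ - ((q * (1 - 2 * p) : ℝ) : ℂ) * phase θ‖ ≤ t - q) : q * robFormula θ p ≤ t := by
  obtain ⟨s, hs, hc⟩ := exists_sign (1 - 2 * p)
  have hs2 : s ^ 2 = 1 := by rw [← sq_abs, hs]; norm_num
  have hqt := (norm_nonneg _).trans h
  rw [norm_le_iff_sq hqt] at h
  refine mul_robXY_le (u := s * ζ.re) (v := s * ζ.im) (by simpa [abs_mul, hs] using ht)
    (by linarith) (le_trans (le_of_eq ?_) h)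
  simp only [Complex.sub_re, Complex.sub_im, Complex.re_ofReal_mul, Complex.im_ofReal_mul, phase]
  set c := |1 - 2 * p|
  rw [hc]
  linear_combination (ζ.re ^ 2 + ζ.im ^ 2 - (q * c * Real.cos θ) ^ 2 -
    (q * c * Real.sin θ) ^ 2) * hs2

theorem weightFormula_feasible (hθ0 : 0 ≤ θ) (hθ1 : θ ≤ Real.pi / 4) (hp0 : 0 ≤ p)
    (hp1 : p ≤ 1) : weightFormula θ p ≤ 1 ∧ ∃ ζ : ℂ, |ζ.re| + |ζ.im| ≤ weightFormula θ p ∧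
      ‖((1 - 2 * p : ℝ) : ℂ) * phase θ - ζ‖ ≤ 1 - weightFormula θ p := by
  obtain ⟨hy, hyx, hxy⟩ := xy_bounds hθ0 hθ1 hp0 hp1
  obtain ⟨u, v, h1, h2, h3⟩ := weightXY_feasible hy hyx hxy
  obtain ⟨s, hs, hc⟩ := exists_sign (1 - 2 * p)
  have hs2 : s ^ 2 = 1 := by rw [← sq_abs, hs]; norm_num
  change weightXY _ _ ≤ 1 ∧ ∃ ζ : ℂ, |ζ.re| + |ζ.im| ≤ weightXY _ _ ∧ _ ≤ 1 - weightXY _ _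
  refine ⟨h2, ⟨s * u, s * v⟩, by simpa [abs_mul, hs] using h1, ?_⟩
  rw [norm_le_iff_sq (by linarith)]
  refine le_trans (le_of_eq ?_) h3
  rw [hc]
  simp only [Complex.sub_re, Complex.sub_im, Complex.re_ofReal_mul, Complex.im_ofReal_mul, phase,
    abs_mul, hs, abs_abs, one_mul]
  linear_combination ((u - |1 - 2 * p| * Real.cos θ) ^ 2 + (v - |1 - 2 * p| * Real.sin θ) ^ 2) * hs2

theorem le_mul_weightFormula (hθ0 : 0 ≤ θ) (hθ1 : θ ≤ Real.pi / 4) (hp0 : 0 ≤ p) (hp1 : p ≤ 1)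
    {q t : ℝ} {ζ : ℂ} (ht : |ζ.re| + |ζ.im| ≤ t)
    (h : ‖((q * (1 - 2 * p) : ℝ) : ℂ) * phase θ - ζ‖ ≤ q - t) : t ≤ q * weightFormula θ p := by
  obtain ⟨hy, hyx, hxy⟩ := xy_bounds hθ0 hθ1 hp0 hp1
  obtain ⟨s, hs, hc⟩ := exists_sign (1 - 2 * p)
  have hs2 : s ^ 2 = 1 := by rw [← sq_abs, hs]; norm_num
  have hqt := (norm_nonneg _).trans h
  rw [norm_le_iff_sq hqt] at h
  refine le_mul_weightXY (u := s * ζ.re) (v := s * ζ.im) hy hyx hxy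
    (by simpa [abs_mul, hs] using ht) (by linarith) (le_trans (le_of_eq ?_) h)
  simp only [Complex.sub_re, Complex.sub_im, Complex.re_ofReal_mul, Complex.im_ofReal_mul, phase]
  set c := |1 - 2 * p|
  rw [hc]
  linear_combination (ζ.re ^ 2 + ζ.im ^ 2 - (q * c * Real.cos θ) ^ 2 -
    (q * c * Real.sin θ) ^ 2) * hs2

theorem xyState_eq (θ p : ℝ) :
    xyState θ p = toQubit (bloch 1 (((1 - 2 * p : ℝ) : ℂ) * phase θ)) := by
  have hph : phase θ = Real.cos θ + Real.sin θ * Complex.I := by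
    apply Complex.ext <;> simp [phase, -Complex.ofReal_cos, -Complex.ofReal_sin]
  refine qMat_one_ext fun m m' => ?_
  rw [toQubit_bit, hph]
  simp only [xyState, Matrix.smul_apply, Matrix.add_apply, opX, opY, pauliString_bit,
    Matrix.one_apply, bit_inj]
  fin_cases m <;> fin_cases m' <;> simp [pauli, bloch, Complex.conj_ofReal, -Complex.ofReal_cos,
    -Complex.ofReal_sin]

/-! ### The Choi state of the noisy rotation -/

theorem exp_smul_opZ (c : ℂ) : NormedSpace.exp (c • opZ) =
    (Matrix.diagonal fun a => Complex.exp (c * (-1) ^ (a 0 : ℕ)) : QMat 1) := by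
  have h : c • opZ = (Matrix.diagonal fun a => c * (-1) ^ (a 0 : ℕ) : QMat 1) := by
    refine qMat_one_ext fun m m' => ?_
    rw [Matrix.smul_apply, opZ, pauliString_bit, Matrix.diagonal_apply]
    simp only [bit_inj]
    fin_cases m <;> fin_cases m' <;> simp [pauli, bit]
  rw [h, Matrix.exp_diagonal]
  congr 1
  ext a
  rw [Pi.coe_exp, Complex.exp_eq_exp_ℂ]

/-- The `I` and `Z` branches of the noise keep the Choi state in the code `0`, and the `X` and `Y`
branches move it to the code `1`. -/
theorem choi_noisyRotZ (θ p0 px py pz : ℝ) :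
    choi (noisyRotZ θ p0 px py pz) = codeMat fun b => bloch (![p0 + pz, px + py] b)
      (((![p0 - pz, px - py] b : ℝ) : ℂ) * phase θ) := by
  have hcomp (A B C D : QMat 1) :
      sandwich A B ∘ₗ sandwich C D = sandwich (A * C) (D * B) := by
    ext1 x
    simp [sandwich, Matrix.mul_assoc]
  have hph : phase θ = Complex.exp (θ / 2 * Complex.I) * Complex.exp (θ / 2 * Complex.I) := by
    rw [← Complex.exp_add, ← add_mul, add_halves, Complex.exp_mul_I]
    apply Complex.ext <;> simp [phase, ← Complex.ofReal_cos, ← Complex.ofReal_sin]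
  have hph' : starRingEnd ℂ (phase θ) =
      Complex.exp (-(θ / 2 * Complex.I)) * Complex.exp (-(θ / 2 * Complex.I)) := by
    rw [hph, map_mul, ← Complex.exp_conj, map_mul, map_div₀, Complex.conj_ofReal, Complex.conj_I,
      Complex.conj_ofNat, mul_neg]
  have hinv : Complex.exp (θ / 2 * Complex.I) * Complex.exp (-(θ / 2 * Complex.I)) = 1 := by
    rw [← Complex.exp_add, add_neg_cancel, Complex.exp_zero]
  set R : QMat 1 := Matrix.diagonal fun a => Complex.exp (-(θ / 2 * Complex.I) * (-1) ^ (a 0 : ℕ))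
    with hR
  set R' : QMat 1 := Matrix.diagonal fun a => Complex.exp (θ / 2 * Complex.I * (-1) ^ (a 0 : ℕ))
    with hR'
  have hrot : rotZ θ = sandwich R R' := by
    rw [rotZ, exp_smul_opZ, exp_smul_opZ, hR, hR']
    congr 3
    · ext a; push_cast; ring_nf
    · ext a; push_cast; ring_nf
  have hsum : noisyRotZ θ p0 px py pz = p0 • sandwich R R' + px • sandwich (opX * R) (R' * opX) +
      py • sandwich (opY * R) (R' * opY) + pz • sandwich (opZ * R) (R' * opZ) := by
    rw [noisyRotZ, pauliNoise, hrot]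
    simp only [LinearMap.add_comp, LinearMap.smul_comp, LinearMap.id_comp, hcomp]
    rfl
  have hchoi : choi (noisyRotZ θ p0 px py pz) = p0 • choi (sandwich R R') +
      px • choi (sandwich (opX * R) (R' * opX)) + py • choi (sandwich (opY * R) (R' * opY)) +
      pz • choi (sandwich (opZ * R) (R' * opZ)) := by
    rw [hsum]
    rfl
  rw [hchoi]
  refine ext_codeBit fun b m b' m' => ?_
  rw [codeMat_codeBit]
  simp only [Matrix.add_apply, Matrix.smul_apply, codeBit, choi_sandwich, hR, hR',
    Matrix.mul_diagonal, Matrix.diagonal_mul, opX, opY, opZ, pauliString_bit,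
    Matrix.diagonal_apply, bit_inj]
  fin_cases b <;> fin_cases b' <;> fin_cases m <;> fin_cases m' <;>
    simp [pauli, bit, bloch, hph'] <;> try simp only [hph]
  all_goals
    clear hph hph' hchoi hsum hrot hR hR' hcomp
    generalize Complex.exp (θ / 2 * Complex.I) = e at *
    generalize Complex.exp (-(θ / 2 * Complex.I)) = f at *
  · linear_combination ((p0 + pz) / 2) * hinv
  · ring
  · ring
  · linear_combination ((p0 + pz) / 2) * hinv
  · linear_combination ((px + py) / 2) * hinv - py / 2 * e * f * Complex.I_mul_I
  · linear_combination py / 2 * f * f * Complex.I_mul_I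
  · linear_combination py / 2 * e * e * Complex.I_mul_I
  · linear_combination ((px + py) / 2) * hinv - py / 2 * e * f * Complex.I_mul_I

/-! ### Robustness and weight of the states and channels -/

theorem trace_of_mem_stabStates {n : ℕ} {σ : QMat n} (hσ : σ ∈ stabStates n) : σ.trace = 1 := by
  have hconv : Convex ℝ {τ : QMat n | τ.trace = 1} := by
    intro σ hσ τ hτ a b _ _ hab
    rw [Set.mem_ofPred_eq] at *
    rw [Matrix.trace_add, Matrix.trace_smul, Matrix.trace_smul, hσ, hτ, ← add_smul, hab, one_smul]
  exact convexHull_min (fun τ hτ => trace_of_mem_pureStabStates hτ) hconv hσ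

theorem InOctahedralCone.smul {N : Matrix (Fin 2) (Fin 2) ℂ} (hN : InOctahedralCone N) {l : ℝ}
    (hl : 0 ≤ l) : |((l : ℂ) * (2 * N 1 0)).re| + |((l : ℂ) * (2 * N 1 0)).im| ≤
      l * (N 0 0 + N 1 1).re := by
  rw [Complex.re_ofReal_mul, Complex.im_ofReal_mul, abs_mul, abs_mul, abs_of_nonneg hl, ← mul_add]
  exact mul_le_mul_of_nonneg_left hN hl

theorem norm_le_of_posSemidef_smul_sub_bloch {N : Matrix (Fin 2) (Fin 2) ℂ} {l q : ℝ} {z : ℂ}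
    (h : (l • N - bloch q z).PosSemidef) :
    ‖(l : ℂ) * (2 * N 1 0) - z‖ ≤ l * (N 0 0 + N 1 1).re - q := by
  convert norm_le_of_posSemidef h using 1
  · congr 1
    simp [bloch]; ring
  · simp [bloch]; ring

theorem norm_le_of_posSemidef_bloch_sub_smul {N : Matrix (Fin 2) (Fin 2) ℂ} {l q : ℝ} {z : ℂ}
    (h : (bloch q z - l • N).PosSemidef) :
    ‖z - (l : ℂ) * (2 * N 1 0)‖ ≤ q - l * (N 0 0 + N 1 1).re := by
  convert norm_le_of_posSemidef h using 1
  · congr 1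
    simp [bloch]; ring
  · simp [bloch]; ring

theorem posSemidef_toQubit {N : Matrix (Fin 2) (Fin 2) ℂ} (h : N.PosSemidef) :
    (toQubit N).PosSemidef := h.submatrix _

theorem isStateRobustness_xyState {θ p : ℝ} (hθ0 : 0 ≤ θ) (hθ1 : θ ≤ Real.pi / 4) (hp0 : 0 ≤ p)
    (hp1 : p ≤ 1) : IsStateRobustness (xyState θ p) (robFormula θ p) := by
  rw [xyState_eq]
  constructor
  · obtain ⟨h1, ζ, hζ, hd⟩ := robFormula_feasible hθ0 hθ1 hp0 hp1
    obtain ⟨σ, hσ, hs⟩ := exists_stabStates_smul_eq hζ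
    refine ⟨h1, σ, hσ, ?_⟩
    rw [hs]
    have := posSemidef_toQubit (posSemidef_bloch hd)
    rwa [← bloch_sub] at this
  · rintro l ⟨hl, σ, hσ, h⟩
    have hN := norm_le_of_posSemidef_smul_sub_bloch (N := σ.submatrix bit bit) (h.submatrix bit)
    have hc := (inOctahedralCone_of_mem_stabStates_one hσ).smul (zero_le_one.trans hl)
    have htr := trace_of_mem_stabStates hσ
    rw [Matrix.trace, sum_bit] at htr
    simp only [Matrix.diag_apply] at htr
    simp only [Matrix.submatrix_apply, htr, Complex.one_re, mul_one] at hN hc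
    simpa using mul_robFormula_le (p := p) (q := 1) hc (by simpa using hN)

theorem isStateWeight_xyState {θ p : ℝ} (hθ0 : 0 ≤ θ) (hθ1 : θ ≤ Real.pi / 4) (hp0 : 0 ≤ p)
    (hp1 : p ≤ 1) : IsStateWeight (xyState θ p) (weightFormula θ p) := by
  rw [xyState_eq]
  obtain ⟨h1, ζ, hζ, hd⟩ := weightFormula_feasible hθ0 hθ1 hp0 hp1
  constructor
  · obtain ⟨σ, hσ, hs⟩ := exists_stabStates_smul_eq hζ
    refine ⟨h1, σ, hσ, ?_⟩
    rw [hs]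
    have := posSemidef_toQubit (posSemidef_bloch hd)
    rwa [← bloch_sub] at this
  · rintro l ⟨hl, σ, hσ, h⟩
    -- a negative `l` is below the claimed maximum, which is nonnegative
    rcases le_total l 0 with hl0 | hl0
    · exact hl0.trans (le_trans (by positivity) hζ)
    have hN := norm_le_of_posSemidef_bloch_sub_smul (N := σ.submatrix bit bit) (h.submatrix bit)
    have hc := (inOctahedralCone_of_mem_stabStates_one hσ).smul hl0
    have htr := trace_of_mem_stabStates hσ
    rw [Matrix.trace, sum_bit] at htr
    simp only [Matrix.diag_apply] at htr
    simp only [Matrix.submatrix_apply, htr, Complex.one_re, mul_one] at hN hc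
    simpa using le_mul_weightFormula hθ0 hθ1 hp0 hp1 (q := 1) hc (by simpa using hN)

/-- The traces of the two blocks of the Choi state of a channel add up to `1`. -/
theorem sum_re_choi {M : SuperOp 1} (hM : M ∈ csp 1) :
    ∑ b, (choi M (codeBit b 0) (codeBit b 0) + choi M (codeBit b 1) (codeBit b 1)).re = 1 := by
  have h := trace_of_mem_stabStates (hM.2 1 _ joinQubits_maxEntangled_mem)
  rw [trace_joinQubits, Matrix.trace, Fintype.sum_prod_type] at h
  simp only [sum_bit, Matrix.diag_apply] at h
  have h' := congrArg Complex.re h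
  simp only [Complex.add_re, Complex.one_re] at h'
  rw [← h']
  simp only [Fin.sum_univ_two, codeBit, Complex.add_re, choi]
  simp only [add_zero, zero_add, show (1 + 1 : Fin 2) = 0 from rfl]
  ring

/-- If the Choi state of a channel is a mixture, with weights `q b`, of the states `ρ(θ, p b)`
encoded in the two codes, then its robustness is the mean of the robustnesses of these states. -/
theorem isChannelRobustness_of_choi_eq {θ : ℝ} (hθ0 : 0 ≤ θ) (hθ1 : θ ≤ Real.pi / 4)
    {q p : Fin 2 → ℝ} (hq : ∀ b, 0 ≤ q b) (hq1 : ∑ b, q b = 1) (hp0 : ∀ b, 0 ≤ p b)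
    (hp1 : ∀ b, p b ≤ 1) {E : SuperOp 1} (hE : choi E = codeMat fun b => bloch (q b)
      (((q b * (1 - 2 * p b) : ℝ) : ℂ) * phase θ)) :
    IsChannelRobustness E (∑ b, q b * robFormula θ (p b)) := by
  choose h1 ζ hζ hd using fun b => robFormula_feasible hθ0 hθ1 (hp0 b) (hp1 b)
  constructor
  · obtain ⟨M, hM, hJ⟩ := exists_csp_smul_choi_eq (t := fun b => q b * robFormula θ (p b))
      (z := fun b => (q b : ℂ) * ζ b) fun b => by
        rw [Complex.re_ofReal_mul, Complex.im_ofReal_mul, abs_mul, abs_mul, abs_of_nonneg (hq b),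
          ← mul_add]
        exact mul_le_mul_of_nonneg_left (hζ b) (hq b)
    refine ⟨?_, M, hM, ?_⟩
    · rw [← hq1]
      exact Finset.sum_le_sum fun b _ => le_mul_of_one_le_right (hq b) (h1 b)
    · rw [hJ, hE, codeMat_sub]
      refine posSemidef_codeMat fun b => ?_
      have := (posSemidef_bloch (hd b)).smul (hq b)
      rw [smul_bloch] at this
      rw [bloch_sub]
      convert this using 2
      · ring
      · push_cast; ring
  · rintro l ⟨hl, M, hM, h⟩
    have hb (b) : q b * robFormula θ (p b) ≤
        l * (choi M (codeBit b 0) (codeBit b 0) + choi M (codeBit b 1) (codeBit b 1)).re := by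
      refine mul_robFormula_le ((inOctahedralCone_choi hM b).smul (zero_le_one.trans hl)) ?_
      refine norm_le_of_posSemidef_smul_sub_bloch
        (N := (choi M).submatrix (codeBit b) (codeBit b)) ?_
      have := h.submatrix (codeBit b)
      rwa [hE, Matrix.submatrix_sub, Pi.sub_apply, Pi.sub_apply, submatrix_codeMat] at this
    calc _ ≤ _ := Finset.sum_le_sum fun b _ => hb b
      _ = l := by rw [← Finset.mul_sum, sum_re_choi hM, mul_one]

/-- The counterpart of `isChannelRobustness_of_choi_eq` for the weight. -/
theorem isChannelWeight_of_choi_eq {θ : ℝ} (hθ0 : 0 ≤ θ) (hθ1 : θ ≤ Real.pi / 4)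
    {q p : Fin 2 → ℝ} (hq : ∀ b, 0 ≤ q b) (hq1 : ∑ b, q b = 1) (hp0 : ∀ b, 0 ≤ p b)
    (hp1 : ∀ b, p b ≤ 1) {E : SuperOp 1} (hE : choi E = codeMat fun b => bloch (q b)
      (((q b * (1 - 2 * p b) : ℝ) : ℂ) * phase θ)) :
    IsChannelWeight E (∑ b, q b * weightFormula θ (p b)) := by
  choose h1 ζ hζ hd using fun b => weightFormula_feasible hθ0 hθ1 (hp0 b) (hp1 b)
  constructor
  · obtain ⟨M, hM, hJ⟩ := exists_csp_smul_choi_eq (t := fun b => q b * weightFormula θ (p b))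
      (z := fun b => (q b : ℂ) * ζ b) fun b => by
        rw [Complex.re_ofReal_mul, Complex.im_ofReal_mul, abs_mul, abs_mul, abs_of_nonneg (hq b),
          ← mul_add]
        exact mul_le_mul_of_nonneg_left (hζ b) (hq b)
    refine ⟨?_, M, hM, ?_⟩
    · rw [← hq1]
      exact Finset.sum_le_sum fun b _ => mul_le_of_le_one_right (hq b) (h1 b)
    · rw [hJ, hE, codeMat_sub]
      refine posSemidef_codeMat fun b => ?_
      have := (posSemidef_bloch (hd b)).smul (hq b)
      rw [smul_bloch] at this
      rw [bloch_sub]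
      convert this using 2
      · ring
      · push_cast; ring
  · rintro l ⟨hl, M, hM, h⟩
    -- a negative `l` is below the claimed maximum, which is nonnegative
    rcases le_total l 0 with hl0 | hl0
    · exact hl0.trans (Finset.sum_nonneg fun b _ =>
        mul_nonneg (hq b) (le_trans (by positivity) (hζ b)))
    have hb (b) : l * (choi M (codeBit b 0) (codeBit b 0) +
        choi M (codeBit b 1) (codeBit b 1)).re ≤ q b * weightFormula θ (p b) := by
      refine le_mul_weightFormula hθ0 hθ1 (hp0 b) (hp1 b)
        ((inOctahedralCone_choi hM b).smul hl0) ?_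
      refine norm_le_of_posSemidef_bloch_sub_smul
        (N := (choi M).submatrix (codeBit b) (codeBit b)) ?_
      have := h.submatrix (codeBit b)
      rwa [hE, Matrix.submatrix_sub, Pi.sub_apply, Pi.sub_apply, submatrix_codeMat] at this
    calc l = _ := by rw [← Finset.mul_sum, sum_re_choi hM, mul_one]
      _ ≤ _ := Finset.sum_le_sum fun b _ => hb b

/-- The dephasing probability of a branch with weight `a + b`. For `a = b = 0` it has the junk value
`0`, which is admissible too. -/
theorem div_add_bounds {a b : ℝ} (ha : 0 ≤ a) (hb : 0 ≤ b) :
    0 ≤ b / (a + b) ∧ b / (a + b) ≤ 1 ∧ (a + b) * (1 - 2 * (b / (a + b))) = a - b := by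
  have hab := add_nonneg ha hb
  refine ⟨div_nonneg hb hab, div_le_one_of_le₀ (by linarith) hab, ?_⟩
  rcases hab.eq_or_lt' with h | h
  · rw [h]; linarith
  · field_simp; ring

theorem choi_noisyRotZ_eq (θ : ℝ) {p0 px py pz : ℝ} (h0 : 0 ≤ p0) (hx : 0 ≤ px) (hy : 0 ≤ py)
    (hz : 0 ≤ pz) : choi (noisyRotZ θ p0 px py pz) =
      codeMat fun b => bloch (![p0 + pz, px + py] b) (((![p0 + pz, px + py] b *
        (1 - 2 * ![pz / (p0 + pz), py / (px + py)] b) : ℝ) : ℂ) * phase θ) := by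
  rw [choi_noisyRotZ]
  congr 1
  funext b
  congr 3
  fin_cases b
  · exact (div_add_bounds h0 hz).2.2.symm
  · exact (div_add_bounds hx hy).2.2.symm

end Magic

end

theorem lemma2 (θ : ℝ) (hθ0 : 0 ≤ θ) (hθ1 : θ ≤ Real.pi / 4) :
    (∀ p : ℝ, 0 ≤ p → p ≤ 1 →
      Magic.IsStateRobustness (Magic.xyState θ p) (Magic.robFormula θ p) ∧
      Magic.IsStateWeight (Magic.xyState θ p) (Magic.weightFormula θ p)) ∧
    (∀ p0 px py pz : ℝ, 0 ≤ p0 → 0 ≤ px → 0 ≤ py → 0 ≤ pz → p0 + px + py + pz = 1 →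
      Magic.IsChannelRobustness (Magic.noisyRotZ θ p0 px py pz)
        ((p0 + pz) * Magic.robFormula θ (pz / (p0 + pz)) +
          (px + py) * Magic.robFormula θ (py / (px + py))) ∧
      Magic.IsChannelWeight (Magic.noisyRotZ θ p0 px py pz)
        ((p0 + pz) * Magic.weightFormula θ (pz / (p0 + pz)) +
          (px + py) * Magic.weightFormula θ (py / (px + py)))) := by
  refine ⟨fun p hp0 hp1 => ⟨Magic.isStateRobustness_xyState hθ0 hθ1 hp0 hp1,
    Magic.isStateWeight_xyState hθ0 hθ1 hp0 hp1⟩, fun p0 px py pz h0 hx hy hz hsum => ?_⟩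
  have hE := Magic.choi_noisyRotZ_eq θ h0 hx hy hz
  obtain ⟨ha0, ha1, -⟩ := Magic.div_add_bounds h0 hz
  obtain ⟨hb0, hb1, -⟩ := Magic.div_add_bounds hx hy
  have hq : ∀ b, 0 ≤ ![p0 + pz, px + py] b :=
    Fin.forall_fin_two.2 ⟨add_nonneg h0 hz, add_nonneg hx hy⟩
  have hq1 : ∑ b, ![p0 + pz, px + py] b = 1 := by
    simp only [Fin.sum_univ_two, Matrix.cons_val_zero, Matrix.cons_val_one]
    linarith
  have hp0 : ∀ b, 0 ≤ ![pz / (p0 + pz), py / (px + py)] b := Fin.forall_fin_two.2 ⟨ha0, hb0⟩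
  have hp1 : ∀ b, ![pz / (p0 + pz), py / (px + py)] b ≤ 1 := Fin.forall_fin_two.2 ⟨ha1, hb1⟩
  have hR := Magic.isChannelRobustness_of_choi_eq hθ0 hθ1 hq hq1 hp0 hp1 hE
  have hW := Magic.isChannelWeight_of_choi_eq hθ0 hθ1 hq hq1 hp0 hp1 hE
  rw [Fin.sum_univ_two] at hR hW
  exact ⟨hR, hW⟩
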